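/- Let $q\ge 2$, let $\Sigma$ be a closed (connected) orientable surface of genus $q$, and let $x\in\Sigma$. Let $\mathrm{Homeo}_+(\mathbb{R})$ be the group of orientation preserving homeomorphisms of the real line with the compact-open topology, and let $\mathrm{Rep}(\pi_1(\Sigma,x),\mathrm{Homeo}_+(\mathbb{R}))$ be the set of group homomorphisms $\rho:\pi_1(\Sigma,x)\to \mathrm{Homeo}_+(\mathbb{R})$ with the topology of pointwise convergence ($\rho_n\to\rho$ if and only if $\rho_n(g)\to\rho(g)$ in $\mathrm{Homeo}_+(\mathbb{R})$ for every $g\in\pi_1(\Sigma,x)$). Then the subspace $$\mathrm{Rep}_\#(\pi_1(\Sigma,x),\mathrm{Homeo}_+(\mathbb{R}))=\{\rho : \text{there is no } y\in\mathbb{R} \text{ with } \rho(g)(y)=y \text{ for all } g\in\pi_1(\Sigma,x)\}$$ of representations without global fixed points is connected (and nonempty). -/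

import Mathlib

noncomputable section

/-- The point at parameter `s ∈ [0,1]` of the `k`-th side of the closed unit disc, viewed as a
polygon whose `4 * q` sides are the consecutive arcs of angle `2 * π / (4 * q)` of the unit circle
(counterclockwise, starting at `1`). -/
def polygonSide (q k : ℕ) (s : ℝ) : Metric.closedBall (0 : ℂ) 1 :=
  ⟨(Circle.exp (2 * Real.pi * ((k + s) / (4 * q))) : ℂ), by
    rw [mem_closedBall_zero_iff]; exact (Circle.norm_coe _).le⟩

/-- The side identifications of the `4 * q`-gon with boundary word
`a₁ b₁ a₁⁻¹ b₁⁻¹ ⋯ a_q b_q a_q⁻¹ b_q⁻¹`: in each block of four consecutive sides, the first is glued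
to the third and the second to the fourth, in both cases reversing the direction. -/
inductive PolygonGluing (q : ℕ) :
    Metric.closedBall (0 : ℂ) 1 → Metric.closedBall (0 : ℂ) 1 → Prop
  | side_a (i : Fin q) (s : ℝ) (hs : s ∈ Set.Icc (0 : ℝ) 1) :
      PolygonGluing q (polygonSide q (4 * i) s) (polygonSide q (4 * i + 2) (1 - s))
  | side_b (i : Fin q) (s : ℝ) (hs : s ∈ Set.Icc (0 : ℝ) 1) :
      PolygonGluing q (polygonSide q (4 * i + 1) s) (polygonSide q (4 * i + 3) (1 - s))

/-- The standard closed orientable surface of genus `q` (for `1 ≤ q`), with the quotient topology: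
the quotient of the `4 * q`-gon by the equivalence relation generated by the gluing. -/
abbrev GenusSurface (q : ℕ) : Type := Quot (PolygonGluing q)

/-- `S` is a closed (connected) orientable surface of genus `q`, for `1 ≤ q`. -/
def IsClosedOrientableSurface (q : ℕ) (S : Type*) [TopologicalSpace S] : Prop :=
  Nonempty (S ≃ₜ GenusSurface q)

/-- The group `Homeo₊(ℝ)` of orientation preserving (that is, increasing) homeomorphisms of the
real line, under composition. -/
def HomeoPlus : Subgroup (ℝ ≃ₜ ℝ) where
  carrier := {f | StrictMono f}
  mul_mem' {f g} hf hg := StrictMono.comp (g := f) (f := g) hf hg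
  one_mem' := strictMono_id
  inv_mem' {f} hf := by
    intro x y hxy
    by_contra h
    have h2 : f (f⁻¹ y) ≤ f (f⁻¹ x) := StrictMono.monotone hf (not_lt.mp h)
    have e : ∀ z, f (f⁻¹ z) = z := fun z => f.apply_symm_apply z
    rw [e, e] at h2
    exact absurd hxy (not_lt.mpr h2)

/-- The compact-open topology on `Homeo₊(ℝ)`. -/
instance HomeoPlus.instTopologicalSpace : TopologicalSpace HomeoPlus :=
  TopologicalSpace.induced (fun f : HomeoPlus => ((f : ℝ ≃ₜ ℝ) : C(ℝ, ℝ))) inferInstance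

/-- `Rep(G, Homeo₊(ℝ))`, the set of representations of the group `G`. -/
abbrev RepHomeoPlus (G : Type*) [Group G] := G →* HomeoPlus

/-- The topology of pointwise convergence on `Rep(G, Homeo₊(ℝ))`. -/
instance RepHomeoPlus.instTopologicalSpace (G : Type*) [Group G] :
    TopologicalSpace (RepHomeoPlus G) :=
  TopologicalSpace.induced (fun (ρ : RepHomeoPlus G) (g : G) => ρ g) Pi.topologicalSpace

/-- The set of global fixed points of a representation. -/
def globalFix {G : Type*} [Group G] (ρ : RepHomeoPlus G) : Set ℝ :=
  {x | ∀ g : G, (ρ g : ℝ ≃ₜ ℝ) x = x}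

/-- `Rep_#(G, Homeo₊(ℝ))`, the subspace of representations without global fixed points. -/
def RepSharp (G : Type*) [Group G] : Set (RepHomeoPlus G) :=
  {ρ | globalFix ρ = ∅}

end

/-! Two representations without global fixed points can be spliced. Given `ρ₁`, `ρ₂` and `N`, there
is a third such representation `r` which agrees with `ρ₁` on generators over `(-∞, N]`, and whose
conjugate by some translation agrees with `ρ₂` on generators over `[-N, ∞)`. For large `N`, `r` is
close to `ρ₁` and this conjugate is close to `ρ₂`. The conjugates of `r` by all translations form a
connected set inside `RepSharp`, so two open sets covering `RepSharp` and both meeting it must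
overlap on it (`IsSurfaceGroupFor.isConnected_repSharp`).

By the surface relation, splicing (`IsSharpTuple.exists_join`) is a question about tuples of
increasing homeomorphisms whose product of commutators is `1`. To cut the first tuple on the right
(`IsSharpTuple.exists_left`), change all handles but the last, far out, so that beyond some point
they are trivial except for one letter, which becomes a translation. Their word `W` then fixes a far
point `m`, and the last handle has to solve `w u = W⁻¹ u w` up to `m`. Written `w u w⁻¹ = W⁻¹ u`,
this asks for a conjugacy between two homeomorphisms; if both push points in the same direction, it
is built by copying a fundamental domain along the orbits (`exists_conj_of_lt`,
`exists_commutator_extend_far`). The second tuple is cut on the left by reflection, and the two are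
glued at `m`, near which both have the same normal form. The translation prevents `m` from being a
global fixed point. Genus at least two is needed because one handle carries the translation while
another solves the equation.

The presentation of the fundamental group is derived from the polygon. Simple connectedness of the
disc attaches a loop, its holonomy, to each pair of identified points. Charts that contract
compatibly with the gluing show that holonomies generate (`eq_top_of_holonomy_mem`). Conversely,
elements of a group satisfying the relation define a locally constant cocycle, hence a covering of
the surface, whose monodromy is the required homomorphism (`FibreCocycle.exists_monoidHom`). -/

noncomputable section

open CategoryTheory Topology unitInterval

/-! ### Holonomy of a map from a simply connected space. -/

section Development

variable {X S : Type*} [TopologicalSpace X] [TopologicalSpace S]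

/-- The image under `π` of the homotopy class of paths from `x₀` to `x` in a simply connected
space, with its endpoint renamed. -/
def leg [SimplyConnectedSpace X] (π : C(X, S)) (x₀ x : X) {z : S} (hz : π x = z) :
    (⟨π x₀⟩ : FundamentalGroupoid S) ⟶ ⟨z⟩ :=
  Path.Homotopic.Quotient.cast
    ((Path.Homotopic.Quotient.mk (PathConnectedSpace.somePath x₀ x)).map π) rfl hz.symm

variable [SimplyConnectedSpace X] (π : C(X, S)) (x₀ : X)

/-- Simple connectedness makes the chosen path irrelevant: any class from `x₀` to `x` computes the
leg. -/
theorem leg_eq_map (x : X) (c : Path.Homotopic.Quotient x₀ x) :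
    leg π x₀ x rfl = c.map π := by
  rw [leg, Path.Homotopic.Quotient.cast_rfl_rfl]
  congr 1
  exact Subsingleton.elim _ _

theorem leg_self : leg π x₀ x₀ rfl = 𝟙 _ := leg_eq_map π x₀ x₀ (.refl x₀)

theorem leg_comp_map {x y : X} (c : Path.Homotopic.Quotient x y) :
    leg π x₀ x rfl ≫ (c.map π : (⟨π x⟩ : FundamentalGroupoid S) ⟶ ⟨π y⟩) = leg π x₀ y rfl := by
  rw [leg_eq_map π x₀ x (.mk (PathConnectedSpace.somePath x₀ x)),
    leg_eq_map π x₀ y ((Path.Homotopic.Quotient.mk (PathConnectedSpace.somePath x₀ x)).trans c)]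
  exact ((FundamentalGroupoid.map π).map_comp (X := ⟨x₀⟩) (Y := ⟨x⟩) (Z := ⟨y⟩)
    (Path.Homotopic.Quotient.mk (PathConnectedSpace.somePath x₀ x)) c).symm

theorem leg_comp_path {x y : X} (δ : Path x y) {z w : S} (hz : π x = z) (hw : π y = w)
    (γ : Path z w) (h : ∀ t, γ t = π (δ t)) :
    leg π x₀ x hz ≫ (Path.Homotopic.Quotient.mk γ : (⟨z⟩ : FundamentalGroupoid S) ⟶ ⟨w⟩) =
      leg π x₀ y hw := by
  subst hz hw
  rw [← leg_comp_map π x₀ (.mk δ), ← Path.Homotopic.Quotient.mk_map]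
  congr 2
  ext t
  exact h t

/-- The loop going from the base point to `x` and then back from `y`, for `π x = π y`. -/
def holonomy (x y : X) (h : π x = π y) : FundamentalGroup S (π x₀) :=
  leg π x₀ x h ≫ Groupoid.inv (leg π x₀ y rfl)

theorem holonomy_comp_leg {x y : X} (h : π x = π y) {z : S} (hx : π x = z) (hy : π y = z) :
    (holonomy π x₀ x y h : (⟨π x₀⟩ : FundamentalGroupoid S) ⟶ ⟨π x₀⟩) ≫ leg π x₀ y hy =
      leg π x₀ x hx := by
  subst hy
  simp [holonomy]

theorem eq_holonomy {x y : X} {z : S} (hx : π x = z) (hy : π y = z)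
    (k : FundamentalGroup S (π x₀)) (hk : k ≫ leg π x₀ y hy = leg π x₀ x hx) :
    k = holonomy π x₀ x y (hx.trans hy.symm) := by
  rw [← holonomy_comp_leg π x₀ (hx.trans hy.symm) hx hy] at hk
  exact (cancel_mono _).1 hk

theorem holonomy_self (x : X) : holonomy π x₀ x x rfl = 1 :=
  (eq_holonomy π x₀ rfl rfl 1 (Category.id_comp _)).symm

/-- The inner legs at `y` cancel. The factors appear in reverse because multiplication in `End` is
composition from right to left. -/
theorem holonomy_mul {x y z : X} (h : π x = π y) (h' : π y = π z) :
    holonomy π x₀ y z h' * holonomy π x₀ x y h = holonomy π x₀ x z (h.trans h') := by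
  refine eq_holonomy π x₀ (h.trans h') rfl _ ?_
  rw [End.mul_def, Category.assoc, holonomy_comp_leg π x₀ h' h' rfl,
    holonomy_comp_leg π x₀ h (h.trans h') h']

theorem holonomy_symm {x y : X} (h : π x = π y) :
    holonomy π x₀ y x h.symm = (holonomy π x₀ x y h)⁻¹ := by
  rw [eq_inv_iff_mul_eq_one, holonomy_mul, holonomy_self]

/-- Both legs are prolonged by the same path in `S`, which cancels. This allows a pair of identified
points to slide along two glued sides. -/
theorem holonomy_eq_of_path {x y x' y' : X} (δ : Path x x') (ε : Path y y')
    (h : ∀ t, π (δ t) = π (ε t)) (hxy : π x = π y) (hxy' : π x' = π y') :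
    holonomy π x₀ x y hxy = holonomy π x₀ x' y' hxy' := by
  refine eq_holonomy π x₀ hxy' rfl _ ?_
  rw [← leg_comp_path π x₀ ε rfl rfl (ε.map π.continuous) (fun t => rfl), ← Category.assoc,
    holonomy_comp_leg π x₀ hxy hxy rfl]
  exact leg_comp_path π x₀ δ hxy hxy' (ε.map π.continuous) fun t => (h t).symm

end Development

/-- An open subset `U` of the base of `π : X → S` together with a deformation of `π ⁻¹' U` inside
`X`, compatible with `π`, which ends at a locally constant map. -/
structure ContractingChart {X S : Type*} [TopologicalSpace X] [TopologicalSpace S]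
    (π : X → S) where
  U : Set S
  isOpen : IsOpen U
  flow : X → C(I, X)
  flow_zero : ∀ x, π x ∈ U → flow x 0 = x
  continuousOn : ContinuousOn (fun p : X × I => flow p.1 p.2) ((π ⁻¹' U) ×ˢ Set.univ)
  eventually_eq : ∀ x, π x ∈ U → ∀ᶠ y in 𝓝 x, flow y 1 = flow x 1
  compat : ∀ x y, π x = π y → π x ∈ U → ∀ t, π (flow x t) = π (flow y t)

namespace ContractingChart

variable {X S : Type*} [TopologicalSpace X] [TopologicalSpace S] {π : C(X, S)}
  (hπ : IsQuotientMap π) (C : ContractingChart π)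
include hπ

/-- The deformation of `C.U` in the base. -/
def baseFlow (z : S) : C(I, S) :=
  π.comp (C.flow (Function.surjInv hπ.surjective z))

theorem baseFlow_apply {x : X} (hx : π x ∈ C.U) (t : I) :
    C.baseFlow hπ (π x) t = π (C.flow x t) := by
  have h := Function.surjInv_eq hπ.surjective (π x)
  exact C.compat _ _ h (by rwa [h]) t

/-- Treating the flow as a map into a path space lets continuity descend along `π` alone; no product
of a quotient map with the interval is needed. -/
theorem continuousOn_baseFlow : ContinuousOn (C.baseFlow hπ) C.U := by
  rw [hπ.continuousOn_isOpen_iff C.isOpen]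
  have h1 : ContinuousOn (fun x => π.comp (C.flow x)) (π ⁻¹' C.U) := by
    refine ContinuousMap.continuousOn_of_continuousOn_uncurry _ ?_
    exact π.continuous.comp_continuousOn C.continuousOn
  refine h1.congr fun x hx => ?_
  ext t
  exact C.baseFlow_apply hπ hx t

theorem isOpen_baseFlow_one_eq (v : S) : IsOpen {z | z ∈ C.U ∧ C.baseFlow hπ z 1 = v} := by
  rw [← hπ.isOpen_preimage, isOpen_iff_mem_nhds]
  rintro x ⟨hx, hv⟩
  have h3 : ∀ᶠ y in 𝓝 x, π y ∈ C.U :=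
    π.continuous.continuousAt.eventually (C.isOpen.mem_nhds hx)
  filter_upwards [h3, C.eventually_eq x hx] with y hy hy'
  refine ⟨hy, ?_⟩
  rw [C.baseFlow_apply hπ hy, hy', ← C.baseFlow_apply hπ hx, hv]

theorem baseFlow_one_eq (γ : C(I, S)) (hγ : ∀ t, γ t ∈ C.U) (s t : I) :
    C.baseFlow hπ (γ s) 1 = C.baseFlow hπ (γ t) 1 := by
  have key : IsLocallyConstant fun s => C.baseFlow hπ (γ s) 1 := by
    refine (IsLocallyConstant.iff_exists_open _).2 fun s => ?_
    refine ⟨γ ⁻¹' {z | z ∈ C.U ∧ C.baseFlow hπ z 1 = C.baseFlow hπ (γ s) 1},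
      (C.isOpen_baseFlow_one_eq hπ _).preimage γ.continuous, ⟨hγ s, rfl⟩, fun t ht => ht.2⟩
  exact key.apply_eq_of_preconnectedSpace s t

/-- Inside a contracting chart every path is homotopic to the difference of two legs, up to a
holonomy. -/
theorem leg_comp_mk [SimplyConnectedSpace X] (x₀ : X) {z w : S} (γ : Path z w)
    (hγ : ∀ t, γ t ∈ C.U) {x y : X} (hx : π x = z) (hy : π y = w) :
    ∃ (h : π (C.flow x 1) = π (C.flow y 1)),
      leg π x₀ x hx ≫ (Path.Homotopic.Quotient.mk γ : (⟨z⟩ : FundamentalGroupoid S) ⟶ ⟨w⟩) =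
      (holonomy π x₀ (C.flow x 1) (C.flow y 1) h :
        (⟨π x₀⟩ : FundamentalGroupoid S) ⟶ ⟨π x₀⟩) ≫ leg π x₀ y hy := by
  obtain ⟨γ, hz, hw⟩ := γ
  change γ 0 = z at hz
  change γ 1 = w at hw
  replace hγ : ∀ t, γ t ∈ C.U := hγ
  subst hz hw
  have hxU : π x ∈ C.U := hx ▸ hγ 0
  have hyU : π y ∈ C.U := hy ▸ hγ 1
  -- The end of the flow is locally constant on the base, hence constant along `γ`.
  have hc : ∀ s, C.baseFlow hπ (γ s) 1 = π (C.flow x 1) := fun s => by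
    rw [← C.baseFlow_apply hπ hxU, hx, C.baseFlow_one_eq hπ γ hγ s 0]
  have h1 : π (C.flow x 1) = π (C.flow y 1) := by
    rw [← C.baseFlow_apply hπ hyU, hy, ← hc 1]
  refine ⟨h1, ?_⟩
  have hcont : Continuous fun s : I => C.baseFlow hπ (γ s) :=
    (C.continuousOn_baseFlow hπ).comp_continuous γ.continuous hγ
  let F : γ.Homotopy (ContinuousMap.const I (π (C.flow x 1))) :=
    { toFun := fun p => C.baseFlow hπ (γ p.2) p.1
      continuous_toFun := by
        have : Continuous fun p : I × I => C.baseFlow hπ (γ p.2) :=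
          hcont.comp continuous_snd
        exact this.eval continuous_fst
      map_zero_left := fun s => by
        obtain ⟨x', hx'⟩ := hπ.surjective (γ s)
        have : π x' ∈ C.U := hx' ▸ hγ s
        change C.baseFlow hπ (γ s) 0 = γ s
        rw [← hx', C.baseFlow_apply hπ this, C.flow_zero _ this]
      map_one_left := fun s => hc s }
  -- The flow contracts `γ` to a point, so `γ` followed by the track `b` of its end is homotopic to
  -- the track `c` of its start. Both tracks lift to flow lines in `X`, so they only move the legs.
  have hF := Path.Homotopic.map_trans_evalAt F Path.id
  have hF' := Path.Homotopic.Quotient.eq.2 hF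
  rw [Path.Homotopic.Quotient.mk_trans, Path.Homotopic.Quotient.mk_trans] at hF'
  let a : (⟨γ 0⟩ : FundamentalGroupoid S) ⟶ ⟨γ 1⟩ :=
    Path.Homotopic.Quotient.mk (⟨γ, rfl, rfl⟩ : Path (γ 0) (γ 1))
  let b : (⟨γ 1⟩ : FundamentalGroupoid S) ⟶ ⟨π (C.flow x 1)⟩ :=
    Path.Homotopic.Quotient.mk (F.evalAt 1)
  let c : (⟨γ 0⟩ : FundamentalGroupoid S) ⟶ ⟨π (C.flow x 1)⟩ :=
    Path.Homotopic.Quotient.mk (F.evalAt 0)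
  have habc : a ≫ b = c := by
    refine Eq.trans hF' ?_
    exact Category.comp_id c
  have hxc : leg π x₀ x hx ≫ c = leg π x₀ (C.flow x 1) rfl :=
    leg_comp_path π x₀ (⟨C.flow x, C.flow_zero x hxU, rfl⟩ : Path x (C.flow x 1)) hx rfl
      (F.evalAt 0) fun t => by
        change C.baseFlow hπ (γ 0) t = _
        rw [← hx, C.baseFlow_apply hπ hxU]
        rfl
  have hyb : leg π x₀ y hy ≫ b = leg π x₀ (C.flow y 1) h1.symm :=
    leg_comp_path π x₀ (⟨C.flow y, C.flow_zero y hyU, rfl⟩ : Path y (C.flow y 1)) hy h1.symm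
      (F.evalAt 1) fun t => by
        change C.baseFlow hπ (γ 1) t = _
        rw [← hy, C.baseFlow_apply hπ hyU]
        rfl
  change leg π x₀ x hx ≫ a = _
  rw [← cancel_mono b, Category.assoc, habc, hxc, Category.assoc, hyb,
    holonomy_comp_leg π x₀ h1 rfl h1.symm]

end ContractingChart

/-- Subdivide the path so that each piece lies in one chart; by `ContractingChart.leg_comp_mk` each
piece contributes one holonomy. Intermediate points are lifted to `X` arbitrarily, with no
continuity between pieces. -/
theorem exists_leg_comp_mk_eq {X S ι : Type*} [TopologicalSpace X] [TopologicalSpace S]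
    [SimplyConnectedSpace X] {π : C(X, S)} (hπ : IsQuotientMap π)
    (C : ι → ContractingChart π) (hC : ∀ z, ∃ i, z ∈ (C i).U) (x₀ : X)
    (K : Subgroup (FundamentalGroup S (π x₀)))
    (hK : ∀ x y (h : π x = π y), holonomy π x₀ x y h ∈ K)
    {z w : S} (γ : Path z w) {x' x : X} (hx' : π x' = z) (hx : π x = w) :
    ∃ k ∈ K, leg π x₀ x' hx' ≫
      (Path.Homotopic.Quotient.mk γ : (⟨z⟩ : FundamentalGroupoid S) ⟶ ⟨w⟩) =
        (k : (⟨π x₀⟩ : FundamentalGroupoid S) ⟶ ⟨π x₀⟩) ≫ leg π x₀ x hx := by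
  obtain ⟨t, ht0, htm, ⟨n, hn⟩, ht⟩ := exists_monotone_Icc_subset_open_cover_unitInterval
    (c := fun i => γ ⁻¹' (C i).U) (fun i => (C i).isOpen.preimage γ.continuous)
    (fun s _ => Set.mem_iUnion.2 (hC (γ s)))
  let q (s s' : I) : (⟨γ s⟩ : FundamentalGroupoid S) ⟶ ⟨γ s'⟩ :=
    Path.Homotopic.Quotient.mk (γ.subpath s s')
  have hq (r s s' : I) : q r s ≫ q s s' = q r s' :=
    Path.Homotopic.Quotient.eq.2 ⟨Path.Homotopy.subpathTransSubpath γ r s s'⟩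
  have key : ∀ n, ∀ x (hx : π x = γ (t n)) (x' : X) (hx' : π x' = γ 0), ∃ k ∈ K,
      leg π x₀ x' hx' ≫ q 0 (t n) =
        (k : (⟨π x₀⟩ : FundamentalGroupoid S) ⟶ ⟨π x₀⟩) ≫ leg π x₀ x hx := by
    intro n
    induction n with
    | zero =>
      intro x hx x' hx'
      rw [ht0] at hx
      have h0 : q 0 0 = 𝟙 _ := by
        simp only [q, Path.subpath_self]
        rfl
      have hx2 := hx'.trans hx.symm
      refine ⟨_, hK x' x hx2, ?_⟩
      have e : ∀ s (hs : s = (0 : I)) (hxs : π x = γ s), leg π x₀ x' hx' ≫ q 0 s =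
          (holonomy π x₀ x' x hx2 : (⟨π x₀⟩ : FundamentalGroupoid S) ⟶ ⟨π x₀⟩) ≫
            leg π x₀ x hxs := by
        rintro s rfl hxs
        rw [h0, Category.comp_id, holonomy_comp_leg π x₀ hx2 hx' hxs]
      exact e _ ht0 _
    | succ n ih =>
      intro x hx x' hx'
      obtain ⟨y, hy⟩ := hπ.surjective (γ (t n))
      obtain ⟨k, hk, hk'⟩ := ih y hy x' hx'
      obtain ⟨i, hi⟩ := ht n
      have hsub : ∀ s, γ.subpath (t n) (t (n + 1)) s ∈ (C i).U := fun s => by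
        have h1 : γ.subpath (t n) (t (n + 1)) s ∈ Set.range (γ.subpath (t n) (t (n + 1))) :=
          ⟨s, rfl⟩
        rw [Path.range_subpath_of_le _ _ _ (htm n.le_succ)] at h1
        obtain ⟨r, hr, hr'⟩ := h1
        rw [← hr']
        exact hi hr
      obtain ⟨h, h'⟩ := (C i).leg_comp_mk hπ x₀ (γ.subpath (t n) (t (n + 1))) hsub hy hx
      refine ⟨holonomy π x₀ _ _ h * k, K.mul_mem (hK _ _ h) hk, ?_⟩
      rw [← hq 0 (t n) (t (n + 1)), ← Category.assoc, hk', Category.assoc, End.mul_def,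
        Category.assoc]
      congr 1
  have e : ∀ s (hs : s = (1 : I)) (hxs : π x = γ s) (hx0 : π x' = γ 0), ∃ k ∈ K,
      leg π x₀ x' hx0 ≫ q 0 s =
        (k : (⟨π x₀⟩ : FundamentalGroupoid S) ⟶ ⟨π x₀⟩) ≫ leg π x₀ x hxs := by
    rintro s rfl hxs hx0
    have := key n
    rw [hn n le_rfl] at this
    exact this x hxs x' hx0
  obtain ⟨γ, hz, hw⟩ := γ
  change γ 0 = z at hz
  change γ 1 = w at hw
  subst hz hw
  obtain ⟨k, hk, hk'⟩ := e 1 rfl hx hx'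
  refine ⟨k, hk, ?_⟩
  rw [← hk']
  simp only [q, Path.subpath_zero_one]
  rfl

/-- If contracting charts cover the base, holonomies generate the fundamental group. -/
theorem eq_top_of_holonomy_mem {X S ι : Type*} [TopologicalSpace X] [TopologicalSpace S]
    [SimplyConnectedSpace X] {π : C(X, S)} (hπ : IsQuotientMap π)
    (C : ι → ContractingChart π) (hC : ∀ z, ∃ i, z ∈ (C i).U) (x₀ : X)
    (K : Subgroup (FundamentalGroup S (π x₀)))
    (hK : ∀ x y (h : π x = π y), holonomy π x₀ x y h ∈ K) : K = ⊤ := by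
  rw [eq_top_iff]
  rintro g -
  obtain ⟨γ, rfl⟩ := Path.Homotopic.Quotient.mk_surjective g
  obtain ⟨k, hk, h⟩ := exists_leg_comp_mk_eq hπ C hC x₀ K hK γ (x' := x₀) (x := x₀) rfl rfl
  rw [leg_self, Category.id_comp] at h
  have h2 := h.trans (Category.comp_id _)
  rw [h2]
  exact hk

end

/-! ### Coverings and homomorphisms from cocycles. -/

noncomputable section

open CategoryTheory Topology unitInterval

/-- A family of locally constant functions on the preimages of an open cover, with values in a
group, which differ by a common left factor on any two points of the same fibre. -/
structure FibreCocycle {X S : Type*} [TopologicalSpace X] [TopologicalSpace S]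
    (π : X → S) (H : Type*) [Group H] (ι : Type*) where
  U : ι → Set S
  isOpen : ∀ i, IsOpen (U i)
  cover : ∀ z, ∃ i, z ∈ U i
  Φ : ι → X → H
  eventually_eq : ∀ i x, π x ∈ U i → ∀ᶠ y in 𝓝 x, Φ i y = Φ i x
  compat : ∀ x y, π x = π y → ∃ c, ∀ i, π x ∈ U i → Φ i y = c * Φ i x

namespace FibreCocycle

variable {X S H ι : Type*} [TopologicalSpace X] [TopologicalSpace S] {π : C(X, S)}
  [Group H] (hπ : IsQuotientMap π) (A : FibreCocycle π H ι)

/-- The transition functions of the principal bundle attached to a cocycle. -/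
def transition (i j : ι) (z : S) : H :=
  (A.Φ i (Function.surjInv hπ.surjective z))⁻¹ * A.Φ j (Function.surjInv hπ.surjective z)

/-- The left factor `c` is common to all indices, so it cancels in `(Φ i)⁻¹ * Φ j`; the quotient is
a function on the base. -/
theorem transition_apply {i j : ι} {x : X} (hi : π x ∈ A.U i) (hj : π x ∈ A.U j) :
    A.transition hπ i j (π x) = (A.Φ i x)⁻¹ * A.Φ j x := by
  obtain ⟨c, hc⟩ := A.compat x _ (Function.surjInv_eq hπ.surjective (π x)).symm
  rw [transition, hc i hi, hc j hj]
  group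

variable [TopologicalSpace H] [DiscreteTopology H]

/-- The principal bundle with discrete fibre attached to a cocycle. -/
def core : FiberBundleCore ι S H where
  baseSet := A.U
  isOpen_baseSet := A.isOpen
  indexAt z := (A.cover z).choose
  mem_baseSet_at z := (A.cover z).choose_spec
  coordChange i j z v := v * A.transition hπ i j z
  coordChange_self i z _ v := by simp [transition]
  continuousOn_coordChange i j := by
    have h1 : ContinuousOn (A.transition hπ i j) (A.U i ∩ A.U j) := by
      rw [hπ.continuousOn_isOpen_iff ((A.isOpen i).inter (A.isOpen j))]
      intro x hx
      refine ContinuousAt.continuousWithinAt ?_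
      refine (tendsto_const_nhds (x := A.transition hπ i j (π x))).congr' ?_
      have h3 : ∀ᶠ y in 𝓝 x, π y ∈ A.U i ∩ A.U j :=
        π.continuous.continuousAt.eventually
          (((A.isOpen i).inter (A.isOpen j)).mem_nhds hx)
      filter_upwards [h3, A.eventually_eq i x hx.1, A.eventually_eq j x hx.2] with y hy hyi hyj
      simp only [Function.comp]
      rw [A.transition_apply hπ hy.1 hy.2, A.transition_apply hπ hx.1 hx.2, hyi, hyj]
    have h2 : Continuous fun p : H × H => p.1 * p.2 := continuous_of_discreteTopology
    exact h2.comp_continuousOn (continuousOn_snd.prodMk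
      (h1.comp continuousOn_fst fun p hp => hp.1))
  coordChange_comp i j k z _ v := by simp [transition, mul_assoc]

/-- The total space of the bundle attached to a cocycle. -/
abbrev Total : Type _ := (A.core hπ).TotalSpace

/-- The fibre coordinate of a point of the total space, in the preferred chart. -/
def coord (p : A.Total hπ) : H := p.2

/-- The point of the total space with given base point and fibre coordinate. -/
def point (z : S) (v : H) : A.Total hπ := ⟨z, v⟩

instance : MulAction H (A.Total hπ) where
  smul g p := A.point hπ p.1 (g * A.coord hπ p)
  one_smul p := congrArg (A.point hπ p.1) (one_mul (A.coord hπ p))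
  mul_smul g h p := congrArg (A.point hπ p.1) (mul_assoc g h (A.coord hπ p))

theorem continuous_iff_total {Y : Type*} [TopologicalSpace Y] (f : Y → A.Total hπ) :
    Continuous f ↔ ∀ (i : ι) (s : Set (S × H)), IsOpen s →
      IsOpen {y | (f y).1 ∈ A.U i ∧
        ((f y).1, A.coord hπ (f y) *
          A.transition hπ ((A.core hπ).indexAt (f y).1) i (f y).1) ∈ s} := by
  rw [continuous_generateFrom_iff]
  simp only [Set.mem_iUnion, Set.mem_singleton_iff, exists_prop]
  constructor
  · intro h i s hs
    exact h _ ⟨i, s, hs, rfl⟩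
  · rintro h _ ⟨i, s, hs, rfl⟩
    exact h i s hs

theorem isOpen_total (i : ι) (s : Set (S × H)) (hs : IsOpen s) :
      IsOpen {p : A.Total hπ | p.1 ∈ A.U i ∧
        (p.1, A.coord hπ p * A.transition hπ ((A.core hπ).indexAt p.1) i p.1) ∈ s} :=
  (A.continuous_iff_total hπ id).1 continuous_id i s hs

/-- Coordinate changes multiply on the right, so left multiplication by `H` is well defined on the
total space. It is free and transitive on fibres. -/
theorem isQuotientCoveringMap : IsQuotientCoveringMap (A.core hπ).proj H where
  toIsQuotientMap := by
    refine (FiberBundle.isCoveringMap (F := H) (E := (A.core hπ).Fiber)).isQuotientMap ?_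
    exact fun z => ⟨⟨z, (1 : H)⟩, rfl⟩
  continuous_const_smul g := by
    rw [continuous_iff_total]
    intro i s hs
    have hc : Continuous fun p : S × H => (p.1, g * p.2) :=
      continuous_fst.prodMk
        ((continuous_of_discreteTopology (f := fun v : H => g * v)).comp continuous_snd)
    have := A.isOpen_total hπ i _ (hs.preimage hc)
    simp only [Set.mem_preimage, ← mul_assoc] at this
    exact this
  apply_eq_iff_mem_orbit {e₁ e₂} := by
    constructor
    · intro h
      obtain ⟨z, v⟩ := e₁
      obtain ⟨w, v'⟩ := e₂
      change z = w at h
      subst h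
      refine ⟨A.coord hπ ⟨z, v⟩ * (A.coord hπ ⟨z, v'⟩)⁻¹, congrArg (A.point hπ z) ?_⟩
      exact inv_mul_cancel_right (A.coord hπ ⟨z, v⟩) (A.coord hπ ⟨z, v'⟩)
    · rintro ⟨g, rfl⟩
      rfl
  disjoint e := by
    obtain ⟨z, v⟩ := e
    let i := (A.core hπ).indexAt z
    refine ⟨_, (A.isOpen_total hπ i {p | p.2 = A.coord hπ ⟨z, v⟩ * A.transition hπ i i z}
      ((isOpen_discrete {A.coord hπ ⟨z, v⟩ * A.transition hπ i i z}).preimage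
        continuous_snd)).mem_nhds
      ⟨(A.core hπ).mem_baseSet_at z, rfl⟩, ?_⟩
    rintro g ⟨_, ⟨⟨w, a⟩, ⟨h1, h2⟩, rfl⟩, h3, h4⟩
    change A.coord hπ ⟨w, a⟩ * _ = _ at h2
    change (g * A.coord hπ ⟨w, a⟩) * A.transition hπ _ _ w = _ at h4
    rw [← h2, mul_assoc] at h4
    exact mul_eq_right.1 h4

/-- The lift of `π` to the total space. -/
def lift : C(X, A.Total hπ) where
  toFun x := A.point hπ (π x) (A.Φ ((A.core hπ).indexAt (π x)) x)
  continuous_toFun := by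
    rw [continuous_iff_total]
    intro i s hs
    have h1 : {x : X | π x ∈ A.U i ∧ (π x, A.Φ ((A.core hπ).indexAt (π x)) x *
        A.transition hπ ((A.core hπ).indexAt (π x)) i (π x)) ∈ s} =
        {x : X | π x ∈ A.U i ∧ (π x, A.Φ i x) ∈ s} := by
      ext x
      refine and_congr_right fun hx => ?_
      rw [A.transition_apply hπ ((A.core hπ).mem_baseSet_at (π x)) hx, mul_inv_cancel_left]
    refine h1 ▸ isOpen_iff_mem_nhds.2 ?_
    rintro x ⟨hx, hxs⟩
    have h2 : Continuous fun y => (π y, A.Φ i x) := by fun_prop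
    filter_upwards [π.continuous.continuousAt.eventually ((A.isOpen i).mem_nhds hx),
      A.eventually_eq i x hx, h2.continuousAt.eventually (hs.mem_nhds hxs)] with y h3 h4 h5
    exact ⟨h3, by rwa [h4]⟩

theorem lift_eq_smul {x y : X} (h : π x = π y) (c : H)
    (hc : ∀ i, π x ∈ A.U i → A.Φ i y = c * A.Φ i x) : A.lift hπ y = c • A.lift hπ x := by
  have h2 := hc _ ((A.core hπ).mem_baseSet_at (π x))
  change A.point hπ (π y) (A.Φ ((A.core hπ).indexAt (π y)) y) =
    A.point hπ (π x) (c * A.Φ ((A.core hπ).indexAt (π x)) x)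
  rw [← h2, h]

/-- The leg is the image of a path in `X`, and `lift` sends that path to a path over the leg. -/
theorem monodromy_leg [SimplyConnectedSpace X] (x₀ x : X) {z : S} (hx : π x = z) :
    (A.isQuotientCoveringMap hπ).isCoveringMap.monodromy (leg π x₀ x hx) ⟨A.lift hπ x₀, rfl⟩ =
      ⟨A.lift hπ x, hx⟩ :=
  (A.isQuotientCoveringMap hπ).isCoveringMap.monodromy_eq_of_map_eq
    (ex := ⟨A.lift hπ x₀, rfl⟩) (ey := ⟨A.lift hπ x, hx⟩)
    ((Path.Homotopic.Quotient.mk (PathConnectedSpace.somePath x₀ x)).map (A.lift hπ)) (by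
      subst hx
      rfl)

end FibreCocycle

/-- A cocycle defines a homomorphism of the fundamental group, which sends a holonomy to the
factor by which the cocycle changes. -/
theorem FibreCocycle.exists_monoidHom {X S H ι : Type*} [TopologicalSpace X] [TopologicalSpace S]
    [SimplyConnectedSpace X] {π : C(X, S)} [Group H] (hπ : IsQuotientMap π)
    (A : FibreCocycle π H ι) (x₀ : X) :
    ∃ ρ : FundamentalGroup S (π x₀) →* H, ∀ x y (h : π x = π y) (c : H),
      (∀ i, π x ∈ A.U i → A.Φ i y = c * A.Φ i x) → ρ (holonomy π x₀ x y h) = c := by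
  let : TopologicalSpace H := ⊥
  have : DiscreteTopology H := ⟨rfl⟩
  let hp := A.isQuotientCoveringMap hπ
  let e : (A.core hπ).proj ⁻¹' {π x₀} := ⟨A.lift hπ x₀, rfl⟩
  -- Deck transformations give values in the opposite group; inversion brings them back to `H`,
  -- which is why `c⁻¹` is the value to be checked.
  refine ⟨(MulEquiv.inv' H).symm.toMonoidHom.comp (hp.fundamentalGroupToMulOpposite e),
    fun x y h c hc => ?_⟩
  suffices hp.fundamentalGroupToMulOpposite e (holonomy π x₀ x y h) = MulOpposite.op c⁻¹ by
    simp [this]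
  rw [hp.fundamentalGroupToMulOpposite_apply_eq_Iff]
  have h1 : hp.toPermFiber (π x₀) c⁻¹ e = hp.isCoveringMap.monodromy (holonomy π x₀ x y h) e := by
    -- Transport along the leg of `y`: the holonomy followed by it is the leg of `x`, so both sides
    -- become lifts of points of `X`, related by `c`.
    apply (hp.isCoveringMap.monodromy_bijective (leg π x₀ y rfl)).1
    rw [hp.monodromy_toPermFiber, ← hp.isCoveringMap.monodromy_trans_apply]
    have h2 := holonomy_comp_leg π x₀ h h rfl
    change Path.Homotopic.Quotient.trans _ _ = _ at h2
    rw [h2]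
    simp only [e]
    rw [A.monodromy_leg hπ x₀ x h, A.monodromy_leg hπ x₀ y rfl]
    apply Subtype.ext
    rw [hp.toPermFiber_apply_apply_coe]
    change c⁻¹ • A.lift hπ y = A.lift hπ x
    rw [A.lift_eq_smul hπ h c hc, inv_smul_smul]
  rw [← h1, hp.toPermFiber_apply_apply_coe]
  rfl

end

/-! ### Sides of the polygon and gluing-invariant contractions. -/

noncomputable section

open CategoryTheory Topology unitInterval

section PolygonSide

theorem coe_polygonSide (q k : ℕ) (s : ℝ) :
    (polygonSide q k s : ℂ) = Complex.exp (2 * Real.pi * ((k + s) / (4 * q)) * Complex.I) := by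
  simp [polygonSide, Circle.coe_exp]

theorem norm_polygonSide (q k : ℕ) (s : ℝ) : ‖(polygonSide q k s : ℂ)‖ = 1 :=
  Circle.norm_coe _

theorem continuous_polygonSide (q k : ℕ) : Continuous (polygonSide q k) := by
  refine Continuous.subtype_mk ?_ _
  fun_prop

theorem polygonSide_one (q k : ℕ) : polygonSide q k 1 = polygonSide q (k + 1) 0 := by
  apply Subtype.ext
  simp [coe_polygonSide]

variable {q : ℕ} (hq : 0 < q)
include hq

theorem polygonSide_period (s : ℝ) : polygonSide q (4 * q) s = polygonSide q 0 s := by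
  apply Subtype.ext
  rw [coe_polygonSide, coe_polygonSide, Complex.exp_eq_exp_iff_exists_int]
  refine ⟨1, ?_⟩
  have : (q : ℂ) ≠ 0 := by exact_mod_cast hq.ne'
  push_cast
  field_simp
  ring

/-- The `4 * q`-th power forgets which side a point is on. It takes the value `1` at vertices and
`-1` at midpoints, so functions of it treat all sides alike. -/
theorem polygonSide_pow (k : ℕ) (s : ℝ) :
    (polygonSide q k s : ℂ) ^ (4 * q) = Complex.exp (2 * Real.pi * s * Complex.I) := by
  rw [coe_polygonSide, ← Complex.exp_nat_mul, Complex.exp_eq_exp_iff_exists_int]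
  refine ⟨k, ?_⟩
  have : (q : ℂ) ≠ 0 := by exact_mod_cast hq.ne'
  push_cast
  field_simp
  ring

theorem polygonSide_injOn {k l : ℕ} (hk : k < 4 * q) (hl : l < 4 * q) {s t : ℝ}
    (hs : s ∈ Set.Ico (0 : ℝ) 1) (ht : t ∈ Set.Ico (0 : ℝ) 1)
    (h : polygonSide q k s = polygonSide q l t) : k = l ∧ s = t := by
  have h1 := congrArg Subtype.val h
  rw [coe_polygonSide, coe_polygonSide, Complex.exp_eq_exp_iff_exists_int] at h1
  obtain ⟨n, hn⟩ := h1
  have hqC : (q : ℂ) ≠ 0 := by exact_mod_cast hq.ne'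
  have hqR : (0 : ℝ) < q := by exact_mod_cast hq
  have h2 : (k + s : ℂ) = l + t + n * (4 * q) := by
    have hpi : (Real.pi : ℂ) ≠ 0 := by exact_mod_cast Real.pi_ne_zero
    have hI := Complex.I_ne_zero
    field_simp at hn
    linear_combination hn
  have h3 : (k + s : ℝ) = l + t + n * (4 * q) := by exact_mod_cast h2
  have hk' : (k : ℝ) + 1 ≤ 4 * q := by exact_mod_cast hk
  have hl' : (l : ℝ) + 1 ≤ 4 * q := by exact_mod_cast hl
  have hk0 : (0 : ℝ) ≤ k := k.cast_nonneg
  have hl0 : (0 : ℝ) ≤ l := l.cast_nonneg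
  -- Both `k + s` and `l + t` lie in `[0, 4 * q)`, so they cannot differ by a nonzero number of full
  -- turns.
  have hn0 : n = 0 := by
    have a1 : (n : ℝ) < 1 := by
      by_contra hc
      push Not at hc
      nlinarith [hs.1, hs.2, ht.1, ht.2]
    have a2 : (-1 : ℝ) < n := by
      by_contra hc
      push Not at hc
      nlinarith [hs.1, hs.2, ht.1, ht.2]
    have a1' : n < 1 := by exact_mod_cast a1
    have a2' : -1 < n := by exact_mod_cast a2
    omega
  subst hn0
  have h4 : (k + s : ℝ) = l + t := by simpa using h3
  have hkl : k = l := by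
    have a1 : (k : ℝ) < l + 1 := by linarith [hs.1, ht.2]
    have a2 : (l : ℝ) < k + 1 := by linarith [hs.2, ht.1]
    have a1' : k < l + 1 := by exact_mod_cast a1
    have a2' : l < k + 1 := by exact_mod_cast a2
    omega
  subst hkl
  exact ⟨rfl, by linarith⟩

end PolygonSide

/-- A gluing-invariant open subset of the polygon, with a gluing-invariant deformation which ends
at a locally constant map. -/
structure PolygonChart (q : ℕ) where
  W : Set (Metric.closedBall (0 : ℂ) 1)
  isOpen : IsOpen W
  flow : Metric.closedBall (0 : ℂ) 1 → C(I, Metric.closedBall (0 : ℂ) 1)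
  flow_zero : ∀ x ∈ W, flow x 0 = x
  continuousOn : ContinuousOn (fun p : Metric.closedBall (0 : ℂ) 1 × I => flow p.1 p.2)
    (W ×ˢ Set.univ)
  eventually_eq : ∀ x ∈ W, ∀ᶠ y in 𝓝 x, flow y 1 = flow x 1
  mem_iff : ∀ x y, PolygonGluing q x y → (x ∈ W ↔ y ∈ W)
  gluing : ∀ x y, PolygonGluing q x y → ∀ t, PolygonGluing q (flow x t) (flow y t)

theorem norm_eq_one_of_gluing {q : ℕ} {x y : Metric.closedBall (0 : ℂ) 1}
    (h : PolygonGluing q x y) : ‖(x : ℂ)‖ = 1 ∧ ‖(y : ℂ)‖ = 1 := by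
  cases h <;> exact ⟨norm_polygonSide _ _ _, norm_polygonSide _ _ _⟩

/-- The straight line deformation of a point of the disc to the centre. -/
def radialFlow (x : Metric.closedBall (0 : ℂ) 1) : C(I, Metric.closedBall (0 : ℂ) 1) where
  toFun t := ⟨((1 - t : ℝ) : ℂ) * x, by
    have h1 : ‖(x : ℂ)‖ ≤ 1 := mem_closedBall_zero_iff.1 x.2
    have h2 : |1 - (t : ℝ)| ≤ 1 := abs_le.2 ⟨by linarith [t.2.2], by linarith [t.2.1]⟩
    rw [mem_closedBall_zero_iff, norm_mul, Complex.norm_real, Real.norm_eq_abs]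
    exact mul_le_one₀ h2 (norm_nonneg _) h1⟩
  continuous_toFun := by
    refine Continuous.subtype_mk ?_ _
    fun_prop

open Classical in
/-- The interior of the polygon. -/
def interiorChart (q : ℕ) : PolygonChart q where
  W := {x | ‖(x : ℂ)‖ < 1}
  isOpen := isOpen_lt (by fun_prop) continuous_const
  flow x := if ‖(x : ℂ)‖ < 1 then radialFlow x else ContinuousMap.const I x
  flow_zero x hx := by
    have hx' : ‖(x : ℂ)‖ < 1 := hx
    rw [if_pos hx']
    apply Subtype.ext
    simp [radialFlow]
  continuousOn := by
    have h : Continuous fun p : Metric.closedBall (0 : ℂ) 1 × I => radialFlow p.1 p.2 := by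
      refine Continuous.subtype_mk ?_ _
      fun_prop
    refine h.continuousOn.congr ?_
    rintro ⟨x, t⟩ ⟨hx, -⟩
    have hx' : ‖(x : ℂ)‖ < 1 := hx
    simp only [if_pos hx']
  eventually_eq x hx := by
    have hx' : ‖(x : ℂ)‖ < 1 := hx
    have ho : IsOpen {x : Metric.closedBall (0 : ℂ) 1 | ‖(x : ℂ)‖ < 1} :=
      isOpen_lt (by fun_prop) continuous_const
    filter_upwards [ho.mem_nhds hx] with y hy
    have hy' : ‖(y : ℂ)‖ < 1 := hy
    rw [if_pos hx', if_pos hy']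
    apply Subtype.ext
    simp [radialFlow]
  mem_iff x y h := by
    obtain ⟨h1, h2⟩ := norm_eq_one_of_gluing h
    simp [h1, h2]
  gluing x y h t := by
    obtain ⟨h1, h2⟩ := norm_eq_one_of_gluing h
    simpa [h1, h2] using h

section BoundaryChart

variable {q : ℕ} (hq : 0 < q) (ε : ℂ)

/-- The deformation of a point along the argument and the modulus, towards the points whose
`4 * q`-th power is `ε⁻¹`. -/
def angularFlowFun (q : ℕ) (ε : ℂ) (z : ℂ) (t : ℝ) : ℂ :=
  z * Complex.exp (-t * (Complex.log (ε * z ^ (4 * q)) / (4 * q)))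

variable {ε}

include hq in
theorem norm_angularFlowFun_le (hε : ‖ε‖ = 1) {z : ℂ} (hz : ‖z‖ ≤ 1)
    (hz' : ε * z ^ (4 * q) ∈ Complex.slitPlane) {t : ℝ} (ht : t ∈ I) :
    ‖angularFlowFun q ε z t‖ ≤ 1 := by
  have hqR : (0 : ℝ) < q := by exact_mod_cast hq
  have hz0 : z ≠ 0 := by
    rintro rfl
    apply Complex.slitPlane_ne_zero hz'
    simp [hq.ne']
  have hn : 0 < ‖z‖ := norm_pos_iff.2 hz0
  have hre : (-(t : ℂ) * (Complex.log (ε * z ^ (4 * q)) / (4 * q))).re = -t * Real.log ‖z‖ := by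
    have : (-(t : ℂ) * (Complex.log (ε * z ^ (4 * q)) / (4 * q))) =
      ((-t / (4 * q) : ℝ) : ℂ) * Complex.log (ε * z ^ (4 * q)) := by
      push_cast
      ring
    rw [this, Complex.re_ofReal_mul, Complex.log_re, norm_mul, hε, one_mul, norm_pow,
      Real.log_pow]
    push_cast
    field_simp
  rw [angularFlowFun, norm_mul, Complex.norm_exp, hre]
  have hlog : Real.log ‖z‖ ≤ 0 := Real.log_nonpos hn.le hz
  -- The modulus evolves as `‖z‖ ^ (1 - t)`, which stays at most `1`.
  calc ‖z‖ * Real.exp (-t * Real.log ‖z‖)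
      = Real.exp ((1 - t) * Real.log ‖z‖) := by
        conv_lhs => rw [← Real.exp_log hn, Real.log_exp, ← Real.exp_add]
        ring_nf
    _ ≤ 1 := Real.exp_le_one_iff.2 (mul_nonpos_of_nonneg_of_nonpos (by linarith [ht.2]) hlog)

open Classical in
/-- The deformation of the complement of some rays in the disc to finitely many points of the
boundary. -/
def angularFlow (hq : 0 < q) (hε : ‖ε‖ = 1) (x : Metric.closedBall (0 : ℂ) 1) :
    C(I, Metric.closedBall (0 : ℂ) 1) :=
  if h : ε * (x : ℂ) ^ (4 * q) ∈ Complex.slitPlane then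
    { toFun := fun t => ⟨angularFlowFun q ε x t, by
        rw [mem_closedBall_zero_iff]
        exact norm_angularFlowFun_le hq hε (mem_closedBall_zero_iff.1 x.2) h t.2⟩
      continuous_toFun := by
        refine Continuous.subtype_mk ?_ _
        unfold angularFlowFun
        fun_prop }
  else ContinuousMap.const I x

theorem coe_angularFlow (hε : ‖ε‖ = 1) {x : Metric.closedBall (0 : ℂ) 1}
    (h : ε * (x : ℂ) ^ (4 * q) ∈ Complex.slitPlane) (t : I) :
    (angularFlow hq hε x t : ℂ) = angularFlowFun q ε x t := by
  rw [angularFlow, dif_pos h]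
  rfl

theorem angularFlow_of_notMem (hε : ‖ε‖ = 1) {x : Metric.closedBall (0 : ℂ) 1}
    (h : ε * (x : ℂ) ^ (4 * q) ∉ Complex.slitPlane) (t : I) :
    angularFlow hq hε x t = x := by
  rw [angularFlow, dif_neg h]
  rfl

/-- The parameter `s` of a side is moved to `c` by the deformation with parameter `ε`. -/
structure IsFlowCenter (ε : ℂ) (s c : ℝ) : Prop where
  exp_eq : ε * Complex.exp (2 * Real.pi * s * Complex.I) =
    Complex.exp (2 * Real.pi * (s - c) * Complex.I)
  dist_lt : |s - c| < 1 / 2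
  center : c = 0 ∨ c = 1 / 2 ∨ c = 1

theorem IsFlowCenter.mem_slitPlane {s c : ℝ} (h : IsFlowCenter ε s c) :
    ε * Complex.exp (2 * Real.pi * s * Complex.I) ∈ Complex.slitPlane ∧
    Complex.log (ε * Complex.exp (2 * Real.pi * s * Complex.I)) =
      2 * Real.pi * (s - c) * Complex.I := by
  obtain ⟨h1, h2⟩ := abs_lt.1 h.dist_lt
  have him : (2 * Real.pi * ((s : ℂ) - c) * Complex.I).im = 2 * Real.pi * (s - c) := by
    have : (2 * Real.pi * ((s : ℂ) - c) * Complex.I) =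
      ((2 * Real.pi * (s - c) : ℝ) : ℂ) * Complex.I := by push_cast; ring
    rw [this, Complex.im_ofReal_mul]
    simp
  have hlog : Complex.log (Complex.exp (2 * Real.pi * ((s : ℂ) - c) * Complex.I)) =
      2 * Real.pi * (s - c) * Complex.I := by
    apply Complex.log_exp <;> rw [him] <;> nlinarith [Real.pi_pos]
  rw [h.exp_eq]
  refine ⟨?_, hlog⟩
  rw [Complex.mem_slitPlane_iff_arg]
  refine ⟨?_, Complex.exp_ne_zero _⟩
  rw [← Complex.log_im, hlog, him]
  nlinarith [Real.pi_pos]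

/-- The reversal `s ↦ 1 - s` is complex conjugation of the power, which fixes the real sign `ε`.
This is the compatibility of the flow with the gluing. -/
theorem IsFlowCenter.one_sub (hε : ε = 1 ∨ ε = -1) {s c : ℝ} (h : IsFlowCenter ε s c) :
    IsFlowCenter ε (1 - s) (1 - c) where
  exp_eq := by
    have h1 := congrArg (starRingEnd ℂ) h.exp_eq
    have hc : (starRingEnd ℂ) ε = ε := by rcases hε with rfl | rfl <;> simp
    rw [map_mul, hc, ← Complex.exp_conj, ← Complex.exp_conj] at h1
    simp only [map_mul, map_sub, Complex.conj_ofReal, Complex.conj_I, Complex.conj_ofNat] at h1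
    have h2 : Complex.exp (2 * Real.pi * ((1 - s : ℝ) : ℂ) * Complex.I) =
        Complex.exp (2 * Real.pi * s * -Complex.I) := by
      rw [Complex.exp_eq_exp_iff_exists_int]
      exact ⟨1, by push_cast; ring⟩
    rw [h2, h1]
    congr 1
    push_cast
    ring
  dist_lt := by
    have := h.dist_lt
    rw [abs_sub_comm] at this
    rwa [sub_sub_sub_cancel_left]
  center := by
    rcases h.center with rfl | rfl | rfl <;> norm_num

/-- For `ε = 1` the slit removes the midpoint and each half of the side flows to its vertex; for `ε
= -1` it removes the vertices and the open side flows to its midpoint. -/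
theorem exists_isFlowCenter (hε : ε = 1 ∨ ε = -1) {s : ℝ} (hs : s ∈ Set.Icc (0 : ℝ) 1)
    (h : ε * Complex.exp (2 * Real.pi * s * Complex.I) ∈ Complex.slitPlane) :
    ∃ c, IsFlowCenter ε s c := by
  have hpi : Complex.exp (Real.pi * Complex.I) = -1 := Complex.exp_pi_mul_I
  rcases hε with rfl | rfl
  · rcases lt_trichotomy s (1 / 2) with h1 | h1 | h1
    · exact ⟨0, by simp, abs_lt.2 ⟨by linarith [hs.1], by linarith⟩, Or.inl rfl⟩
    · exfalso
      subst h1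
      have : (2 * Real.pi * ((1 / 2 : ℝ) : ℂ) * Complex.I) = Real.pi * Complex.I := by
        push_cast; ring
      rw [this, hpi] at h
      simp [Complex.mem_slitPlane_iff] at h
      linarith
    · refine ⟨1, ?_, abs_lt.2 ⟨by linarith, by linarith [hs.2]⟩, Or.inr (Or.inr rfl)⟩
      rw [one_mul, Complex.exp_eq_exp_iff_exists_int]
      exact ⟨1, by push_cast; ring⟩
  · have hne : s ≠ 0 ∧ s ≠ 1 := by
      constructor
      · rintro rfl
        simp [Complex.mem_slitPlane_iff] at h
        linarith
      · rintro rfl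
        have : (2 * Real.pi * ((1 : ℝ) : ℂ) * Complex.I) = 2 * Real.pi * Complex.I := by simp
        rw [this, Complex.exp_two_pi_mul_I] at h
        simp [Complex.mem_slitPlane_iff] at h
        linarith
    have h0 : 0 < s := lt_of_le_of_ne hs.1 hne.1.symm
    have h1 : s < 1 := lt_of_le_of_ne hs.2 hne.2
    refine ⟨1 / 2, ?_, abs_lt.2 ⟨by linarith, by linarith⟩, Or.inr (Or.inl rfl)⟩
    have hpi' : Complex.exp (-(Real.pi * Complex.I)) = -1 := by
      rw [Complex.exp_neg, hpi]; norm_num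
    rw [← hpi', ← Complex.exp_add]
    congr 1
    push_cast
    ring

include hq in
theorem polygonSide_mem_slitPlane {s c : ℝ} (h : IsFlowCenter ε s c) (k : ℕ) :
    ε * (polygonSide q k s : ℂ) ^ (4 * q) ∈ Complex.slitPlane := by
  rw [polygonSide_pow hq]
  exact h.mem_slitPlane.1

theorem angularFlow_polygonSide (hε : ‖ε‖ = 1) {s c : ℝ} (h : IsFlowCenter ε s c) (k : ℕ)
    (t : I) :
    angularFlow hq hε (polygonSide q k s) t = polygonSide q k (s - t * (s - c)) := by
  apply Subtype.ext
  rw [coe_angularFlow hq hε (polygonSide_mem_slitPlane hq h k), angularFlowFun,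
    polygonSide_pow hq, h.mem_slitPlane.2, coe_polygonSide, coe_polygonSide, ← Complex.exp_add]
  congr 1
  have : (q : ℂ) ≠ 0 := by exact_mod_cast hq.ne'
  push_cast
  field_simp
  ring

theorem angularFlow_one_pow (hε : ‖ε‖ = 1) {x : Metric.closedBall (0 : ℂ) 1}
    (h : ε * (x : ℂ) ^ (4 * q) ∈ Complex.slitPlane) :
    ε * (angularFlow hq hε x 1 : ℂ) ^ (4 * q) = 1 := by
  rw [coe_angularFlow hq hε h, angularFlowFun, mul_pow, ← Complex.exp_nat_mul]
  have hqC : (q : ℂ) ≠ 0 := by exact_mod_cast hq.ne'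
  have : ((4 * q : ℕ) : ℂ) * (-((1 : I) : ℝ) * (Complex.log (ε * (x : ℂ) ^ (4 * q)) / (4 * q))) =
      - Complex.log (ε * (x : ℂ) ^ (4 * q)) := by
    push_cast
    field_simp
  rw [this, Complex.exp_neg, Complex.exp_log (Complex.slitPlane_ne_zero h), ← mul_assoc,
    mul_inv_cancel₀ (Complex.slitPlane_ne_zero h)]

theorem continuousOn_angularFlow (hε : ‖ε‖ = 1) :
    ContinuousOn (fun p : Metric.closedBall (0 : ℂ) 1 × I => angularFlow hq hε p.1 p.2)
      ({x : Metric.closedBall (0 : ℂ) 1 | ε * (x : ℂ) ^ (4 * q) ∈ Complex.slitPlane} ×ˢ Set.univ) := by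
  rw [Topology.IsInducing.subtypeVal.continuousOn_iff]
  have h : ContinuousOn (fun p : Metric.closedBall (0 : ℂ) 1 × I => angularFlowFun q ε p.1 p.2)
      ({x : Metric.closedBall (0 : ℂ) 1 | ε * (x : ℂ) ^ (4 * q) ∈ Complex.slitPlane} ×ˢ Set.univ) := by
    unfold angularFlowFun
    refine ContinuousOn.mul (by fun_prop) (ContinuousOn.cexp (ContinuousOn.mul (by fun_prop) ?_))
    refine ContinuousOn.div_const (ContinuousOn.clog (by fun_prop) ?_) _
    rintro ⟨x, t⟩ ⟨hx, -⟩
    exact hx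
  refine h.congr ?_
  rintro ⟨x, t⟩ ⟨hx, -⟩
  exact coe_angularFlow hq hε hx t

theorem norm_eq_one_of_sign {ε : ℂ} (hε : ε = 1 ∨ ε = -1) : ‖ε‖ = 1 := by
  rcases hε with rfl | rfl <;> simp

/-- The complement of the rays on which `ε * z ^ (4 * q)` is a nonpositive real. -/
def boundaryChart (hε : ε = 1 ∨ ε = -1) : PolygonChart q where
  W := {x | ε * (x : ℂ) ^ (4 * q) ∈ Complex.slitPlane}
  isOpen := Complex.isOpen_slitPlane.preimage (by fun_prop)
  flow := angularFlow hq (norm_eq_one_of_sign hε)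
  flow_zero x hx := by
    apply Subtype.ext
    rw [coe_angularFlow hq _ hx]
    simp [angularFlowFun]
  continuousOn := continuousOn_angularFlow hq _
  eventually_eq x hx := by
    have hε1 : ‖ε‖ = 1 := norm_eq_one_of_sign hε
    have ho : IsOpen {x : Metric.closedBall (0 : ℂ) 1 |
      ε * (x : ℂ) ^ (4 * q) ∈ Complex.slitPlane} := Complex.isOpen_slitPlane.preimage (by fun_prop)
    -- At time `1` the flow lands in this finite set of roots; being continuous, it is locally
    -- constant there.
    have hfin : {w : ℂ | ε * w ^ (4 * q) = 1}.Finite := by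
      have : {w : ℂ | ε * w ^ (4 * q) = 1} ⊆
          ((Polynomial.nthRoots (4 * q) ε).toFinset : Set ℂ) := by
        intro w hw
        have hεε : ε * ε = 1 := by rcases hε with rfl | rfl <;> simp
        simp only [Finset.mem_coe, Multiset.mem_toFinset]
        rw [Polynomial.mem_nthRoots (by omega)]
        have hw' : ε * w ^ (4 * q) = 1 := hw
        linear_combination ε * hw' - w ^ (4 * q) * hεε
      exact (Finset.finite_toSet _).subset this
    have hcont : ContinuousAt (fun y => (angularFlow hq hε1 y 1 : ℂ)) x := by
      have h1 := (continuousOn_angularFlow hq hε1).comp (s := {x : Metric.closedBall (0 : ℂ) 1 |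
        ε * (x : ℂ) ^ (4 * q) ∈ Complex.slitPlane}) (f := fun y => (y, (1 : I)))
        (by fun_prop) (fun y hy => ⟨hy, trivial⟩)
      exact continuous_subtype_val.continuousAt.comp (h1.continuousAt (ho.mem_nhds hx))
    have hcl : IsClosed ({w : ℂ | ε * w ^ (4 * q) = 1} \ {(angularFlow hq hε1 x 1 : ℂ)}) :=
      (hfin.subset Set.sdiff_subset).isClosed
    filter_upwards [ho.mem_nhds hx, hcont.eventually (hcl.isOpen_compl.mem_nhds (by simp))]
      with y hy hy'
    apply Subtype.ext
    by_contra hne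
    exact hy' ⟨angularFlow_one_pow hq hε1 hy, hne⟩
  mem_iff x y h := by
    have key : ∀ s ∈ Set.Icc (0 : ℝ) 1, ∀ k l,
        ε * (polygonSide q k s : ℂ) ^ (4 * q) ∈ Complex.slitPlane →
        ε * (polygonSide q l (1 - s) : ℂ) ^ (4 * q) ∈ Complex.slitPlane := by
      intro s hs k l h
      rw [polygonSide_pow hq] at h
      obtain ⟨c, hc⟩ := exists_isFlowCenter hε hs h
      exact polygonSide_mem_slitPlane hq (hc.one_sub hε) l
    have key' : ∀ s ∈ Set.Icc (0 : ℝ) 1, ∀ k l,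
        (ε * (polygonSide q k s : ℂ) ^ (4 * q) ∈ Complex.slitPlane ↔
        ε * (polygonSide q l (1 - s) : ℂ) ^ (4 * q) ∈ Complex.slitPlane) := by
      intro s hs k l
      refine ⟨key s hs k l, fun h => ?_⟩
      have := key (1 - s) ⟨by linarith [hs.2], by linarith [hs.1]⟩ l k h
      rwa [sub_sub_cancel] at this
    cases h with
    | side_a i s hs => exact key' s hs _ _
    | side_b i s hs => exact key' s hs _ _
  gluing x y h t := by
    have hε1 : ‖ε‖ = 1 := norm_eq_one_of_sign hε
    have key : ∀ s ∈ Set.Icc (0 : ℝ) 1, ∀ k l, (∀ s' ∈ Set.Icc (0 : ℝ) 1,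
        PolygonGluing q (polygonSide q k s') (polygonSide q l (1 - s'))) →
        PolygonGluing q (angularFlow hq hε1 (polygonSide q k s) t)
          (angularFlow hq hε1 (polygonSide q l (1 - s)) t) := by
      intro s hs k l hg
      by_cases hW : ∃ c, IsFlowCenter ε s c
      · obtain ⟨c, hc⟩ := hW
        rw [angularFlow_polygonSide hq hε1 hc, angularFlow_polygonSide hq hε1 (hc.one_sub hε)]
        have hc01 : c ∈ Set.Icc (0 : ℝ) 1 := by rcases hc.center with rfl | rfl | rfl <;> norm_num
        have := hg (s - t * (s - c)) ⟨by nlinarith [hs.1, hc01.1, t.2.1, t.2.2],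
          by nlinarith [hs.2, hc01.2, t.2.1, t.2.2]⟩
        convert this using 2
        ring
      -- Outside the chart the flow is constant by default at both partners, so the original gluing
      -- persists.
      · have h1 : ∀ s' ∈ Set.Icc (0 : ℝ) 1, (¬ ∃ c, IsFlowCenter ε s' c) → ∀ k,
            ¬ ε * (polygonSide q k s' : ℂ) ^ (4 * q) ∈ Complex.slitPlane := by
          intro s' hs' h' k hk
          rw [polygonSide_pow hq] at hk
          exact h' (exists_isFlowCenter hε hs' hk)
        rw [angularFlow_of_notMem hq hε1 (h1 s hs hW k),
          angularFlow_of_notMem hq hε1 (h1 (1 - s) ⟨by linarith [hs.2], by linarith [hs.1]⟩ ?_ l)]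
        · exact hg s hs
        · rintro ⟨c, hc⟩
          have := hc.one_sub hε
          rw [sub_sub_cancel] at this
          exact hW ⟨_, this⟩
    cases h with
    | side_a i s hs => exact key s hs _ _ fun s' hs' => .side_a i s' hs'
    | side_b i s hs => exact key s hs _ _ fun s' hs' => .side_b i s' hs'

end BoundaryChart

end

/-! ### The surface word and the values of the cocycle. -/

noncomputable section

open CategoryTheory Topology unitInterval

/-- The product of the commutators of `w i` and `u i` for `i < n`, in decreasing order. -/
def surfaceWord {H : Type*} [Group H] (u w : ℕ → H) : ℕ → H
  | 0 => 1
  | n + 1 => w n * u n * (w n)⁻¹ * (u n)⁻¹ * surfaceWord u w n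

theorem map_surfaceWord {G H : Type*} [Group G] [Group H] (ρ : G →* H) (u w : ℕ → G) (n : ℕ) :
    ρ (surfaceWord u w n) = surfaceWord (fun i => ρ (u i)) (fun i => ρ (w i)) n := by
  induction n with
  | zero => exact map_one ρ
  | succ n ih => simp only [surfaceWord, map_mul, map_inv, ih]

theorem surfaceWord_congr {H : Type*} [Group H] {u w u' w' : ℕ → H} {n : ℕ}
    (hu : ∀ i < n, u i = u' i) (hw : ∀ i < n, w i = w' i) :
    surfaceWord u w n = surfaceWord u' w' n := by
  induction n with
  | zero => rfl
  | succ n ih =>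
    rw [surfaceWord, surfaceWord, hu n n.lt_succ_self, hw n n.lt_succ_self,
      ih (fun i hi => hu i (hi.trans n.lt_succ_self)) (fun i hi => hw i (hi.trans n.lt_succ_self))]

/-- The group `G` is presented, as far as homomorphisms to `H` are concerned, by generators
`u 0, w 0, …, u (q - 1), w (q - 1)` and the relation `surfaceWord u w q = 1`. -/
def IsSurfaceGroupFor (H : Type*) [Group H] (q : ℕ) (G : Type*) [Group G] : Prop :=
  ∃ u w : ℕ → G, Subgroup.closure {g | ∃ i < q, g = u i ∨ g = w i} = ⊤ ∧
    surfaceWord u w q = 1 ∧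
    ∀ u' w' : ℕ → H, surfaceWord u' w' q = 1 →
      ∃ ρ : G →* H, ∀ i < q, ρ (u i) = u' i ∧ ρ (w i) = w' i

section VertexValues

variable {H : Type*} [Group H] (u w : ℕ → H)

/-- The values at the vertices of the polygon of the cocycle with jumps `(u i)⁻¹` and `w i`. -/
def vertexValue (k : ℕ) : H :=
  (if k % 4 = 0 then 1 else if k % 4 = 1 then u (k / 4) * (w (k / 4))⁻¹ * (u (k / 4))⁻¹
    else if k % 4 = 2 then (w (k / 4))⁻¹ * (u (k / 4))⁻¹ else (u (k / 4))⁻¹) *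
    surfaceWord u w (k / 4)

theorem vertexValue_zero (i : ℕ) : vertexValue u w (4 * i) = surfaceWord u w i := by
  have h1 : (4 * i) % 4 = 0 := by omega
  have h2 : (4 * i) / 4 = i := by omega
  simp [vertexValue, h2]

theorem vertexValue_one (i : ℕ) : vertexValue u w (4 * i + 1) =
    u i * (w i)⁻¹ * (u i)⁻¹ * surfaceWord u w i := by
  have h1 : (4 * i + 1) % 4 = 1 := by omega
  have h2 : (4 * i + 1) / 4 = i := by omega
  simp [vertexValue, h1, h2]

theorem vertexValue_two (i : ℕ) : vertexValue u w (4 * i + 2) =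
    (w i)⁻¹ * (u i)⁻¹ * surfaceWord u w i := by
  have h1 : (4 * i + 2) % 4 = 2 := by omega
  have h2 : (4 * i + 2) / 4 = i := by omega
  simp [vertexValue, h1, h2]

theorem vertexValue_three (i : ℕ) : vertexValue u w (4 * i + 3) =
    (u i)⁻¹ * surfaceWord u w i := by
  have h1 : (4 * i + 3) % 4 = 3 := by omega
  have h2 : (4 * i + 3) / 4 = i := by omega
  simp [vertexValue, h1, h2]

theorem vertexValue_four (i : ℕ) : vertexValue u w (4 * i + 4) =
    w i * u i * (w i)⁻¹ * (u i)⁻¹ * surfaceWord u w i := by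
  rw [show 4 * i + 4 = 4 * (i + 1) by ring, vertexValue_zero, surfaceWord]

/-- The values at the midpoints of the sides of the polygon of the cocycle with jumps `(u i)⁻¹`
and `w i`. -/
def midpointValue (k : ℕ) : H :=
  if k % 4 = 2 then (u (k / 4))⁻¹ else if k % 4 = 3 then w (k / 4) else 1

theorem midpointValue_eq (i : ℕ) : midpointValue u w (4 * i) = 1 ∧
    midpointValue u w (4 * i + 1) = 1 ∧ midpointValue u w (4 * i + 2) = (u i)⁻¹ ∧
    midpointValue u w (4 * i + 3) = w i := by
  have h1 : (4 * i + 1) % 4 = 1 := by omega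
  have h2 : (4 * i + 2) % 4 = 2 := by omega
  have h2' : (4 * i + 2) / 4 = i := by omega
  have h3 : (4 * i + 3) % 4 = 3 := by omega
  have h3' : (4 * i + 3) / 4 = i := by omega
  simp [midpointValue, h1, h2, h2', h3, h3']

open Classical in
/-- The values of the cocycle at the centres of the charts of the polygon. -/
def centerValue (q : ℕ) (z : Metric.closedBall (0 : ℂ) 1) : H :=
  if h : ∃ k < 4 * q, z = polygonSide q k 0 then vertexValue u w h.choose
  else if h : ∃ k < 4 * q, z = polygonSide q k (1 / 2) then midpointValue u w h.choose else 1

variable {q : ℕ} (hq : 0 < q)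
include hq

theorem centerValue_zero {k : ℕ} (hk : k < 4 * q) :
    centerValue u w q (polygonSide q k 0) = vertexValue u w k := by
  have h : ∃ l < 4 * q, polygonSide q k 0 = polygonSide q l 0 := ⟨k, hk, rfl⟩
  rw [centerValue, dif_pos h]
  have := (polygonSide_injOn hq hk h.choose_spec.1 (by norm_num) (by norm_num)
    h.choose_spec.2).1
  rw [← this]

/-- The relation is used here: the last side ends at vertex `0`, so the value `surfaceWord u w q`
reached after a full turn has to be `1`. -/
theorem centerValue_one (hr : surfaceWord u w q = 1) {k : ℕ} (hk : k < 4 * q) :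
    centerValue u w q (polygonSide q k 1) = vertexValue u w (k + 1) := by
  rw [polygonSide_one]
  rcases Nat.lt_or_ge (k + 1) (4 * q) with h | h
  · exact centerValue_zero u w hq h
  · have h2 : k + 1 = 4 * q := by omega
    rw [h2, polygonSide_period hq, centerValue_zero u w hq (by omega), vertexValue_zero, hr]
    exact vertexValue_zero u w 0

theorem centerValue_half {k : ℕ} (hk : k < 4 * q) :
    centerValue u w q (polygonSide q k (1 / 2)) = midpointValue u w k := by
  have h0 : ¬ ∃ l < 4 * q, polygonSide q k (1 / 2) = polygonSide q l 0 := by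
    rintro ⟨l, hl, h⟩
    have := (polygonSide_injOn hq hk hl (by norm_num) (by norm_num) h).2
    norm_num at this
  have h : ∃ l < 4 * q, polygonSide q k (1 / 2) = polygonSide q l (1 / 2) := ⟨k, hk, rfl⟩
  rw [centerValue, dif_neg h0, dif_pos h]
  have := (polygonSide_injOn hq hk h.choose_spec.1 (by norm_num) (by norm_num)
    h.choose_spec.2).1
  rw [← this]

/-- The vertex and midpoint values were chosen so that the jump across a pair of sides is the same
at both ends and in the middle. -/
theorem centerValue_side_a (hr : surfaceWord u w q = 1) {i : ℕ} (hi : i < q) {c : ℝ}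
    (hc : c = 0 ∨ c = 1 / 2 ∨ c = 1) :
    centerValue u w q (polygonSide q (4 * i + 2) (1 - c)) =
      (u i)⁻¹ * centerValue u w q (polygonSide q (4 * i) c) := by
  rcases hc with rfl | rfl | rfl
  · rw [sub_zero, centerValue_one u w hq hr (by omega), centerValue_zero u w hq (by omega),
      vertexValue_three, vertexValue_zero]
  · rw [show (1 - 1 / 2 : ℝ) = 1 / 2 by norm_num, centerValue_half u w hq (by omega),
      centerValue_half u w hq (by omega)]
    simp [midpointValue_eq]
  · rw [sub_self, centerValue_one u w hq hr (by omega), centerValue_zero u w hq (by omega),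
      vertexValue_two, vertexValue_one]
    group

theorem centerValue_side_b (hr : surfaceWord u w q = 1) {i : ℕ} (hi : i < q) {c : ℝ}
    (hc : c = 0 ∨ c = 1 / 2 ∨ c = 1) :
    centerValue u w q (polygonSide q (4 * i + 3) (1 - c)) =
      w i * centerValue u w q (polygonSide q (4 * i + 1) c) := by
  rcases hc with rfl | rfl | rfl
  · rw [sub_zero, centerValue_one u w hq hr (by omega), centerValue_zero u w hq (by omega),
      vertexValue_four, vertexValue_one]
    group
  · rw [show (1 - 1 / 2 : ℝ) = 1 / 2 by norm_num, centerValue_half u w hq (by omega),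
      centerValue_half u w hq (by omega)]
    simp [midpointValue_eq]
  · rw [sub_self, centerValue_one u w hq hr (by omega), centerValue_zero u w hq (by omega),
      vertexValue_two, vertexValue_three]
    group

end VertexValues

/-! ### Charts of the surface and its presentation. -/

section PolygonQuotient

variable {q : ℕ} {S : Type*} [TopologicalSpace S]

/-- `π` is the quotient map of the polygon by its gluing. -/
structure IsPolygonQuotient (q : ℕ) (π : C(Metric.closedBall (0 : ℂ) 1, S)) : Prop where
  isQuotientMap : IsQuotientMap π
  eq_of_gluing : ∀ x y, PolygonGluing q x y → π x = π y
  eqvGen_of_eq : ∀ x y, π x = π y → Relation.EqvGen (PolygonGluing q) x y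

theorem IsClosedOrientableSurface.exists_isPolygonQuotient (h : IsClosedOrientableSurface q S) :
    ∃ π : C(Metric.closedBall (0 : ℂ) 1, S), IsPolygonQuotient q π := by
  obtain ⟨e⟩ := h
  have hq : IsQuotientMap fun x => e.symm (Quot.mk (PolygonGluing q) x) :=
    e.symm.isQuotientMap.comp isQuotientMap_quot_mk
  refine ⟨⟨_, hq.continuous⟩, hq, fun x y h => ?_, fun x y h => ?_⟩
  · exact congrArg e.symm (Quot.sound h)
  · exact Quot.eqvGen_exact (e.symm.injective h)

variable {π : C(Metric.closedBall (0 : ℂ) 1, S)} (hπ : IsPolygonQuotient q π)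
include hπ

theorem IsPolygonQuotient.eq_of_eq {α : Sort*} (F : Metric.closedBall (0 : ℂ) 1 → α)
    (hF : ∀ x y, PolygonGluing q x y → F x = F y) {x y : Metric.closedBall (0 : ℂ) 1}
    (h : π x = π y) : F x = F y :=
  congrArg (Quot.lift F hF) (Quot.eqvGen_sound (hπ.eqvGen_of_eq x y h))

theorem PolygonChart.mem_of_mem_image (C : PolygonChart q) {x : Metric.closedBall (0 : ℂ) 1}
    (hx : π x ∈ π '' C.W) : x ∈ C.W := by
  obtain ⟨y, hy, hxy⟩ := hx
  exact (hπ.eq_of_eq (fun x => x ∈ C.W) (fun x y h => propext (C.mem_iff x y h)) hxy).mp hy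

theorem PolygonChart.preimage_image (C : PolygonChart q) : π ⁻¹' (π '' C.W) = C.W :=
  Set.Subset.antisymm (fun _ hx => C.mem_of_mem_image hπ hx) (Set.subset_preimage_image π C.W)

/-- A chart of the polygon defines a contracting chart of the quotient. -/
def PolygonChart.toContractingChart (C : PolygonChart q) : ContractingChart π where
  U := π '' C.W
  isOpen := by
    rw [← hπ.isQuotientMap.isOpen_preimage, C.preimage_image hπ]
    exact C.isOpen
  flow := C.flow
  flow_zero x hx := C.flow_zero x (C.mem_of_mem_image hπ hx)
  continuousOn := by
    rw [C.preimage_image hπ]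
    exact C.continuousOn
  eventually_eq x hx := C.eventually_eq x (C.mem_of_mem_image hπ hx)
  compat x y h _ t := hπ.eq_of_eq (fun x => π (C.flow x t))
    (fun x y h => hπ.eq_of_gluing _ _ (C.gluing x y h t)) h

omit hπ in
/-- The interior chart and the two boundary charts. -/
def polygonCharts (hq : 0 < q) : Option Bool → PolygonChart q
  | none => interiorChart q
  | some true => boundaryChart hq (Or.inl rfl : (1 : ℂ) = 1 ∨ (1 : ℂ) = -1)
  | some false => boundaryChart hq (Or.inr rfl : (-1 : ℂ) = 1 ∨ (-1 : ℂ) = -1)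

omit hπ in
theorem exists_mem_polygonCharts (hq : 0 < q) (x : Metric.closedBall (0 : ℂ) 1) :
    ∃ i, x ∈ (polygonCharts hq i).W := by
  rcases (mem_closedBall_zero_iff.1 x.2).lt_or_eq with h | h
  · exact ⟨none, h⟩
  · have h0 : (x : ℂ) ^ (4 * q) ≠ 0 := pow_ne_zero _ (norm_pos_iff.1 (by rw [h]; exact one_pos))
    by_cases h1 : (x : ℂ) ^ (4 * q) ∈ Complex.slitPlane
    · refine ⟨some true, ?_⟩
      change (1 : ℂ) * (x : ℂ) ^ (4 * q) ∈ Complex.slitPlane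
      rwa [one_mul]
    · refine ⟨some false, ?_⟩
      change (-1 : ℂ) * (x : ℂ) ^ (4 * q) ∈ Complex.slitPlane
      rw [Complex.mem_slitPlane_iff, not_or, not_lt, not_not] at h1
      rw [neg_one_mul, Complex.mem_slitPlane_iff]
      left
      rw [Complex.neg_re, neg_pos]
      refine lt_of_le_of_ne h1.1 fun h2 => h0 (Complex.ext h2 h1.2)

omit hπ in
/-- A point of a side lying in one of the charts is moved, along with its partner, to a vertex
or to the midpoint of the side. -/
theorem exists_flow_one_eq (hq : 0 < q) (j : Option Bool) {k : ℕ} {s : ℝ}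
    (hs : s ∈ Set.Icc (0 : ℝ) 1) (h : polygonSide q k s ∈ (polygonCharts hq j).W) :
    ∃ c, (c = 0 ∨ c = 1 / 2 ∨ c = 1) ∧
      ∀ l, (polygonCharts hq j).flow (polygonSide q l s) 1 = polygonSide q l c ∧
        (polygonCharts hq j).flow (polygonSide q l (1 - s)) 1 = polygonSide q l (1 - c) := by
  have key : ∀ {ε : ℂ} (hε : ε = 1 ∨ ε = -1), polygonSide q k s ∈ (boundaryChart hq hε).W →
      ∃ c, (c = 0 ∨ c = 1 / 2 ∨ c = 1) ∧
      ∀ l, (boundaryChart hq hε).flow (polygonSide q l s) 1 = polygonSide q l c ∧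
        (boundaryChart hq hε).flow (polygonSide q l (1 - s)) 1 = polygonSide q l (1 - c) := by
    intro ε hε h
    change ε * (polygonSide q k s : ℂ) ^ (4 * q) ∈ Complex.slitPlane at h
    rw [polygonSide_pow hq] at h
    obtain ⟨c, hc⟩ := exists_isFlowCenter hε hs h
    refine ⟨c, hc.center, fun l => ⟨?_, ?_⟩⟩
    · refine (angularFlow_polygonSide hq (norm_eq_one_of_sign hε) hc l 1).trans ?_
      congr 1
      simp
    · refine (angularFlow_polygonSide hq (norm_eq_one_of_sign hε) (hc.one_sub hε) l 1).trans ?_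
      congr 1
      simp
  match j, h with
  | none, h =>
    have h' : ‖(polygonSide q k s : ℂ)‖ < 1 := h
    rw [norm_polygonSide] at h'
    exact absurd h' (lt_irrefl _)
  | some true, h => exact key (Or.inl rfl) h
  | some false, h => exact key (Or.inr rfl) h

end PolygonQuotient

section Presentation

variable {q : ℕ} (hq : 0 < q) {S : Type*} [TopologicalSpace S]
  {π : C(Metric.closedBall (0 : ℂ) 1, S)} (hπ : IsPolygonQuotient q π)

section Cocycle

variable {H : Type*} [Group H] (u w : ℕ → H) (hr : surfaceWord u w q = 1)
include hr

theorem centerValue_flow_side_a {i : ℕ} (hi : i < q) {s : ℝ} (hs : s ∈ Set.Icc (0 : ℝ) 1)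
    (j : Option Bool) (hj : polygonSide q (4 * i) s ∈ (polygonCharts hq j).W) :
    centerValue u w q ((polygonCharts hq j).flow (polygonSide q (4 * i + 2) (1 - s)) 1) =
      (u i)⁻¹ * centerValue u w q ((polygonCharts hq j).flow (polygonSide q (4 * i) s) 1) := by
  obtain ⟨c, hc, hc'⟩ := exists_flow_one_eq hq j hs hj
  rw [(hc' _).1, (hc' _).2, centerValue_side_a u w hq hr hi hc]

theorem centerValue_flow_side_b {i : ℕ} (hi : i < q) {s : ℝ} (hs : s ∈ Set.Icc (0 : ℝ) 1)
    (j : Option Bool) (hj : polygonSide q (4 * i + 1) s ∈ (polygonCharts hq j).W) :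
    centerValue u w q ((polygonCharts hq j).flow (polygonSide q (4 * i + 3) (1 - s)) 1) =
      w i * centerValue u w q ((polygonCharts hq j).flow (polygonSide q (4 * i + 1) s) 1) := by
  obtain ⟨c, hc, hc'⟩ := exists_flow_one_eq hq j hs hj
  rw [(hc' _).1, (hc' _).2, centerValue_side_b u w hq hr hi hc]

/-- The cocycle on the surface with jumps `(u i)⁻¹` and `w i`. -/
def surfaceCocycle : FibreCocycle π H (Option Bool) where
  U j := ((polygonCharts hq j).toContractingChart hπ).U
  isOpen j := ((polygonCharts hq j).toContractingChart hπ).isOpen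
  cover z := by
    obtain ⟨x, rfl⟩ := hπ.isQuotientMap.surjective z
    obtain ⟨j, hj⟩ := exists_mem_polygonCharts hq x
    exact ⟨j, x, hj, rfl⟩
  Φ j x := centerValue u w q ((polygonCharts hq j).flow x 1)
  eventually_eq j x hx := by
    filter_upwards [((polygonCharts hq j).toContractingChart hπ).eventually_eq x hx] with y hy
    exact congrArg _ hy
  -- Factors multiply along chains of gluings. Only the existence of a factor common to all charts
  -- is claimed, so different chains need not be compared.
  compat x y h := by
    induction hπ.eqvGen_of_eq x y h with
    | rel x y hxy =>
      cases hxy with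
      | side_a i s hs =>
        exact ⟨_, fun j hj => centerValue_flow_side_a hq u w hr i.2 hs j
          (PolygonChart.mem_of_mem_image hπ _ hj)⟩
      | side_b i s hs =>
        exact ⟨_, fun j hj => centerValue_flow_side_b hq u w hr i.2 hs j
          (PolygonChart.mem_of_mem_image hπ _ hj)⟩
    | refl x => exact ⟨1, fun j _ => (one_mul _).symm⟩
    | symm x y hxy ih =>
      have hxy' := hπ.eq_of_eq π hπ.eq_of_gluing h.symm
      obtain ⟨c, hc⟩ := ih hxy'
      refine ⟨c⁻¹, fun j hj => ?_⟩
      rw [hc j (hxy'.symm ▸ hj), inv_mul_cancel_left]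
    | trans x y z hxy hyz ih1 ih2 =>
      have hxy' : π x = π y := congrArg (Quot.lift π hπ.eq_of_gluing) (Quot.eqvGen_sound hxy)
      have hyz' : π y = π z := congrArg (Quot.lift π hπ.eq_of_gluing) (Quot.eqvGen_sound hyz)
      obtain ⟨c, hc⟩ := ih1 hxy'
      obtain ⟨c', hc'⟩ := ih2 hyz'
      exact ⟨c' * c, fun j hj => by rw [hc' j (hxy' ▸ hj), hc j hj, mul_assoc]⟩

end Cocycle

instance : ContractibleSpace (Metric.closedBall (0 : ℂ) 1) :=
  (convex_closedBall (0 : ℂ) 1).contractibleSpace ⟨0, by simp⟩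

include hπ

theorem IsPolygonQuotient.side_a {i : ℕ} (hi : i < q) {s : ℝ} (hs : s ∈ Set.Icc (0 : ℝ) 1) :
    π (polygonSide q (4 * i) s) = π (polygonSide q (4 * i + 2) (1 - s)) :=
  hπ.eq_of_gluing _ _ (.side_a ⟨i, hi⟩ s hs)

theorem IsPolygonQuotient.side_b {i : ℕ} (hi : i < q) {s : ℝ} (hs : s ∈ Set.Icc (0 : ℝ) 1) :
    π (polygonSide q (4 * i + 1) s) = π (polygonSide q (4 * i + 3) (1 - s)) :=
  hπ.eq_of_gluing _ _ (.side_b ⟨i, hi⟩ s hs)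

omit hπ in
theorem holonomy_side_eq (x₀ : Metric.closedBall (0 : ℂ) 1) {k l : ℕ}
    (h : ∀ s ∈ Set.Icc (0 : ℝ) 1, π (polygonSide q k s) = π (polygonSide q l (1 - s)))
    {s s' : ℝ} (hs : s ∈ Set.Icc (0 : ℝ) 1) (hs' : s' ∈ Set.Icc (0 : ℝ) 1) :
    holonomy π x₀ _ _ (h s hs) = holonomy π x₀ _ _ (h s' hs') := by
  refine holonomy_eq_of_path π x₀
    ⟨⟨fun t => polygonSide q k (s + t * (s' - s)),
      (continuous_polygonSide q k).comp (by fun_prop)⟩, by simp, by simp⟩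
    ⟨⟨fun t => polygonSide q l (1 - (s + t * (s' - s))),
      (continuous_polygonSide q l).comp (by fun_prop)⟩, by simp, by simp⟩
    (fun t => h _ ?_) _ _
  exact ⟨by nlinarith [hs.1, hs'.1, t.2.1, t.2.2], by nlinarith [hs.2, hs'.2, t.2.1, t.2.2]⟩

open Classical in
/-- The generator of the fundamental group attached to the first side of the `i`-th block. -/
def genU (x₀ : Metric.closedBall (0 : ℂ) 1) (i : ℕ) :
    FundamentalGroup S (π x₀) :=
  if hi : i < q then
    (holonomy π x₀ _ _ (hπ.side_a hi (s := 0) ⟨le_rfl, zero_le_one⟩))⁻¹ else 1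

open Classical in
/-- The generator of the fundamental group attached to the second side of the `i`-th block. -/
def genW (x₀ : Metric.closedBall (0 : ℂ) 1) (i : ℕ) :
    FundamentalGroup S (π x₀) :=
  if hi : i < q then
    holonomy π x₀ _ _ (hπ.side_b hi (s := 0) ⟨le_rfl, zero_le_one⟩) else 1

variable (x₀ : Metric.closedBall (0 : ℂ) 1)

theorem holonomy_side_a {i : ℕ} (hi : i < q) {s : ℝ} (hs : s ∈ Set.Icc (0 : ℝ) 1) :
    holonomy π x₀ _ _ (hπ.side_a hi hs) = (genU hπ x₀ i)⁻¹ := by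
  rw [genU, dif_pos hi, inv_inv]
  exact holonomy_side_eq x₀ (fun s hs => hπ.side_a hi hs) hs ⟨le_rfl, zero_le_one⟩

theorem holonomy_side_b {i : ℕ} (hi : i < q) {s : ℝ} (hs : s ∈ Set.Icc (0 : ℝ) 1) :
    holonomy π x₀ _ _ (hπ.side_b hi hs) = genW hπ x₀ i := by
  rw [genW, dif_pos hi]
  exact holonomy_side_eq x₀ (fun s hs => hπ.side_b hi hs) hs ⟨le_rfl, zero_le_one⟩

include hq in
theorem closure_gen_eq_top :
    Subgroup.closure {g | ∃ i < q, g = genU hπ x₀ i ∨ g = genW hπ x₀ i} = ⊤ := by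
  refine eq_top_of_holonomy_mem hπ.isQuotientMap
    (fun j => (polygonCharts hq j).toContractingChart hπ) (fun z => ?_) x₀ _ fun x y h => ?_
  · obtain ⟨x, rfl⟩ := hπ.isQuotientMap.surjective z
    obtain ⟨j, hj⟩ := exists_mem_polygonCharts hq x
    exact ⟨j, x, hj, rfl⟩
  · induction hπ.eqvGen_of_eq x y h with
    | rel x y hxy =>
      cases hxy with
      | side_a i s hs =>
        rw [holonomy_side_a hπ x₀ i.2 hs]
        exact inv_mem (Subgroup.subset_closure ⟨i, i.2, Or.inl rfl⟩)
      | side_b i s hs =>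
        rw [holonomy_side_b hπ x₀ i.2 hs]
        exact Subgroup.subset_closure ⟨i, i.2, Or.inr rfl⟩
    | refl x =>
      rw [holonomy_self]
      exact one_mem _
    | symm x y hxy ih =>
      rw [holonomy_symm π x₀ h.symm]
      exact inv_mem (ih h.symm)
    | trans x y z hxy hyz ih1 ih2 =>
      have hxy' : π x = π y := congrArg (Quot.lift π hπ.eq_of_gluing) (Quot.eqvGen_sound hxy)
      have hyz' : π y = π z := congrArg (Quot.lift π hπ.eq_of_gluing) (Quot.eqvGen_sound hyz)
      rw [← holonomy_mul π x₀ hxy' hyz']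
      exact mul_mem (ih2 hyz') (ih1 hxy')

/-- All vertices are identified. Passing a block visits the vertices `4i`, `4i+3`, `4i+2`, `4i+1`,
`4i+4`, each move being a side pairing at one end; the four holonomies multiply to a commutator. -/
theorem exists_holonomy_vertex {i : ℕ} (hi : i ≤ q) :
    ∃ h : π (polygonSide q 0 0) = π (polygonSide q (4 * i) 0),
      holonomy π x₀ _ _ h = surfaceWord (genU hπ x₀) (genW hπ x₀) i := by
  induction i with
  | zero => exact ⟨rfl, holonomy_self π x₀ _⟩
  | succ i ih =>
    obtain ⟨h, h'⟩ := ih (by omega)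
    have hi' : i < q := hi
    have z : (0 : ℝ) ∈ Set.Icc (0 : ℝ) 1 := by norm_num
    have o : (1 : ℝ) ∈ Set.Icc (0 : ℝ) 1 := by norm_num
    have e (k : ℕ) : polygonSide q k (1 - 0) = polygonSide q (k + 1) 0 := by
      rw [sub_zero, polygonSide_one]
    have e' (k : ℕ) : polygonSide q k (1 - 1) = polygonSide q k 0 := by rw [sub_self]
    have a0 := holonomy_side_a hπ x₀ hi' z
    have a1 := holonomy_side_a hπ x₀ hi' o
    have b0 := holonomy_side_b hπ x₀ hi' z
    have b1 := holonomy_side_b hπ x₀ hi' o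
    have g0 := hπ.side_a hi' z
    have g1 := hπ.side_a hi' o
    have g2 := hπ.side_b hi' z
    have g3 := hπ.side_b hi' o
    simp only [e, e', polygonSide_one] at a0 a1 b0 b1 g0 g1 g2 g3
    have e4 : 4 * (i + 1) = 4 * i + 3 + 1 := by ring
    rw [e4]
    refine ⟨h.trans (g0.trans (g3.symm.trans (g1.symm.trans g2))), ?_⟩
    rw [← holonomy_mul π x₀ h (g0.trans (g3.symm.trans (g1.symm.trans g2))),
      ← holonomy_mul π x₀ g0 (g3.symm.trans (g1.symm.trans g2)),
      ← holonomy_mul π x₀ g3.symm (g1.symm.trans g2), ← holonomy_mul π x₀ g1.symm g2,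
      holonomy_symm π x₀ g3, holonomy_symm π x₀ g1, h', a0, a1, b0, b1, surfaceWord]
    group

include hq in
theorem isSurfaceGroupFor_of_isPolygonQuotient (H : Type*) [Group H] :
    IsSurfaceGroupFor H q (FundamentalGroup S (π x₀)) := by
  refine ⟨genU hπ x₀, genW hπ x₀, closure_gen_eq_top hq hπ x₀, ?_, fun u w hr => ?_⟩
  · obtain ⟨h, h'⟩ := exists_holonomy_vertex hπ x₀ (le_refl q)
    rw [← h']
    -- Vertex `4 * q` is vertex `0`, so the holonomy equal to the full surface word is trivial.
    have e : ∀ y (h : π (polygonSide q 0 0) = π y), y = polygonSide q 0 0 →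
        holonomy π x₀ _ _ h = 1 := by
      rintro _ h rfl
      exact holonomy_self π x₀ _
    exact e _ h (polygonSide_period hq 0)
  · obtain ⟨ρ, hρ⟩ := (surfaceCocycle hq hπ u w hr).exists_monoidHom hπ.isQuotientMap x₀
    refine ⟨ρ, fun i hi => ⟨?_, ?_⟩⟩
    · rw [genU, dif_pos hi, map_inv, hρ _ _ _ (u i)⁻¹ fun j hj =>
        centerValue_flow_side_a hq u w hr hi (by norm_num) j
          (PolygonChart.mem_of_mem_image hπ _ hj), inv_inv]
    · rw [genW, dif_pos hi]
      exact hρ _ _ _ (w i) fun j hj => centerValue_flow_side_b hq u w hr hi (by norm_num) j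
          (PolygonChart.mem_of_mem_image hπ _ hj)

end Presentation

/-- The fundamental group of a closed orientable surface has the standard presentation. -/
theorem IsClosedOrientableSurface.isSurfaceGroupFor {q : ℕ} (hq : 0 < q) {S : Type*}
    [TopologicalSpace S] (hS : IsClosedOrientableSurface q S) (x : S) (H : Type*) [Group H] :
    IsSurfaceGroupFor H q (FundamentalGroup S x) := by
  obtain ⟨π, hπ⟩ := hS.exists_isPolygonQuotient
  obtain ⟨x₀, rfl⟩ := hπ.isQuotientMap.surjective x
  exact isSurfaceGroupFor_of_isPolygonQuotient hq hπ x₀ H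

end

/-! ### Conjugating increasing homeomorphisms of the line. -/

noncomputable section

open Set

section LineOrderIso

theorem exists_orderIso_of_strictMono {f : ℝ → ℝ} (hf : StrictMono f)
    (hs : Function.Surjective f) : ∃ e : ℝ ≃o ℝ, ∀ x, e x = f x :=
  ⟨hf.orderIsoOfSurjective f hs, fun _ => rfl⟩

theorem exists_orderIso_glue (e₁ e₂ : ℝ ≃o ℝ) {p : ℝ} (h : e₁ p = e₂ p) :
    ∃ e : ℝ ≃o ℝ, (∀ x ≤ p, e x = e₁ x) ∧ ∀ x, p ≤ x → e x = e₂ x := by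
  have hf : StrictMono fun x => if x ≤ p then e₁ x else e₂ x := by
    intro x y hxy
    dsimp only
    split_ifs with h1 h2 h2
    · exact e₁.strictMono hxy
    · exact lt_of_le_of_lt (h ▸ e₁.monotone h1) (e₂.strictMono (not_le.1 h2))
    · linarith
    · exact e₂.strictMono hxy
  have hs : Function.Surjective fun x => if x ≤ p then e₁ x else e₂ x := by
    intro y
    rcases le_total y (e₁ p) with hy | hy
    · refine ⟨e₁.symm y, ?_⟩
      have : e₁.symm y ≤ p := (e₁.symm_apply_le).2 hy
      simp [this]
    · refine ⟨e₂.symm y, ?_⟩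
      have h1 : p ≤ e₂.symm y := (e₂.le_symm_apply).2 (h ▸ hy)
      rcases h1.eq_or_lt with h2 | h2
      · have : y = e₂ p := by rw [h2]; simp
        simp [h, this]
      · simp [not_le.2 h2]
  obtain ⟨e, he⟩ := exists_orderIso_of_strictMono hf hs
  refine ⟨e, fun x hx => by rw [he, if_pos hx], fun x hx => ?_⟩
  rcases hx.eq_or_lt with rfl | hx
  · rw [he, if_pos le_rfl, h]
  · rw [he, if_neg (not_le.2 hx)]

theorem exists_orderIso_affine (p r : ℝ) {s : ℝ} (hs : 0 < s) :
    ∃ e : ℝ ≃o ℝ, ∀ x, e x = r + s * (x - p) := by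
  refine exists_orderIso_of_strictMono (f := fun x => r + s * (x - p)) (fun x y h => ?_) fun y =>
    ⟨p + (y - r) / s, ?_⟩
  · dsimp only
    nlinarith
  · field_simp
    ring

theorem exists_orderIso_max (e₁ e₂ : ℝ ≃o ℝ) : ∃ e : ℝ ≃o ℝ, ∀ x, e x = max (e₁ x) (e₂ x) := by
  refine exists_orderIso_of_strictMono (fun x y h =>
    max_lt_max (e₁.strictMono h) (e₂.strictMono h)) fun y => ?_
  rcases le_total (e₁.symm y) (e₂.symm y) with h | h
  · refine ⟨e₁.symm y, ?_⟩
    have : e₂ (e₁.symm y) ≤ y := by simpa using e₂.monotone h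
    simpa using this
  · refine ⟨e₂.symm y, ?_⟩
    have : e₁ (e₂.symm y) ≤ y := by simpa using e₁.monotone h
    simpa using this

theorem exists_orderIso_min (e₁ e₂ : ℝ ≃o ℝ) : ∃ e : ℝ ≃o ℝ, ∀ x, e x = min (e₁ x) (e₂ x) := by
  refine exists_orderIso_of_strictMono (fun x y h =>
    min_lt_min (e₁.strictMono h) (e₂.strictMono h)) fun y => ?_
  rcases le_total (e₁.symm y) (e₂.symm y) with h | h
  · refine ⟨e₂.symm y, ?_⟩
    have : y ≤ e₁ (e₂.symm y) := by simpa using e₁.monotone h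
    simpa using this
  · refine ⟨e₁.symm y, ?_⟩
    have : y ≤ e₂ (e₁.symm y) := by simpa using e₂.monotone h
    simpa using this

/-- Between `M` and `p` the graph is a segment, increasing because `e M < r`. -/
theorem exists_orderIso_extend (e : ℝ ≃o ℝ) {M p r : ℝ} (hp : M < p) (hr : e M < r) :
    ∃ e' : ℝ ≃o ℝ, (∀ x ≤ M, e' x = e x) ∧ ∀ x, p ≤ x → e' x = r + (x - p) := by
  obtain ⟨l, hl⟩ := exists_orderIso_affine M (e M) (div_pos (sub_pos.2 hr) (sub_pos.2 hp))
  obtain ⟨t, ht⟩ := exists_orderIso_affine p r one_pos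
  obtain ⟨e₁, h1, h1'⟩ := exists_orderIso_glue e l (p := M) (by simp [hl])
  have hpM : p - M ≠ 0 := (sub_pos.2 hp).ne'
  obtain ⟨e₂, h2, h2'⟩ := exists_orderIso_glue e₁ t (p := p) (by
    rw [h1' p hp.le, hl, ht]
    field_simp
    ring)
  refine ⟨e₂, fun x hx => by rw [h2 x (hx.trans hp.le), h1 x hx], fun x hx => ?_⟩
  rw [h2' x hx, ht, one_mul]

/-- A bounded increasing orbit converges to a fixed point of `b`, and there is none in `[x₀, m)`. -/
theorem exists_lt_iterate {b : ℝ ≃o ℝ} {x₀ m : ℝ} (hx₀ : x₀ < m) (hm : b m = m)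
    (hb : ∀ x, x₀ ≤ x → x < m → x < b x) {x : ℝ} (hx : x < m) : ∃ k : ℕ, x < b^[k] x₀ := by
  by_contra hcon
  push Not at hcon
  have hlt : ∀ k : ℕ, b^[k] x₀ < m ∧ x₀ ≤ b^[k] x₀ := by
    intro k
    induction k with
    | zero => exact ⟨hx₀, le_rfl⟩
    | succ k ih =>
      rw [Function.iterate_succ_apply']
      exact ⟨hm ▸ b.strictMono ih.1, ih.2.trans (hb _ ih.2 ih.1).le⟩
  have hmono : Monotone fun k : ℕ => b^[k] x₀ := monotone_nat_of_le_succ fun k => by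
    rw [Function.iterate_succ_apply']
    exact (hb _ (hlt k).2 (hlt k).1).le
  have hbdd : BddAbove (range fun k : ℕ => b^[k] x₀) := ⟨x, by rintro _ ⟨k, rfl⟩; exact hcon k⟩
  have hlim := tendsto_atTop_ciSup hmono hbdd
  have hfix : b (⨆ k, b^[k] x₀) = ⨆ k, b^[k] x₀ :=
    isFixedPt_of_tendsto_iterate hlim b.continuous.continuousAt
  have h1 : (⨆ k, b^[k] x₀) ≤ x := ciSup_le hcon
  have h2 : x₀ ≤ ⨆ k, b^[k] x₀ := le_ciSup hbdd 0
  exact (hb _ h2 (h1.trans_lt hx)).ne' hfix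

/-- A partial conjugacy between two increasing homeomorphisms without fixed points on
`[x₀, m)` and `[y₀, m)`, given on a fundamental domain, extends up to `m`. -/
theorem exists_conj_of_lt {a b g : ℝ ≃o ℝ} {x₀ y₀ m : ℝ} (hx₀ : x₀ < m) (hy₀ : y₀ < m)
    (hbm : b m = m) (hgm : g m = m) (hb : ∀ x, x₀ ≤ x → x < m → x < b x)
    (hg : ∀ y, y₀ ≤ y → y < m → y < g y) (ha : a x₀ = y₀) (hab : a (b x₀) = g y₀) :
    ∃ a' : ℝ ≃o ℝ, (∀ x ≤ b x₀, a' x = a x) ∧ a' m = m ∧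
      ∀ x, x₀ ≤ x → x ≤ m → a' (b x) = g (a' x) := by
  -- One step imposes `α b = g α` above `x₀` by replacing `α` with `g α b⁻¹` beyond `b x₀`. The two
  -- endpoint conditions make the pieces match and are preserved. The iterates stabilise on each
  -- `(-∞, b^[k] x₀]`.
  have step : ∀ α : {α : ℝ ≃o ℝ // α x₀ = y₀ ∧ α (b x₀) = g y₀},
      ∃ β : {α : ℝ ≃o ℝ // α x₀ = y₀ ∧ α (b x₀) = g y₀},
        (∀ x ≤ b x₀, β.1 x = α.1 x) ∧ ∀ x, b x₀ ≤ x → β.1 x = g (α.1 (b.symm x)) := by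
    rintro ⟨α, h1, h2⟩
    obtain ⟨β, h3, h4⟩ := exists_orderIso_glue α (b.symm.trans (α.trans g)) (p := b x₀) (by
      simp [h1, h2])
    refine ⟨⟨β, ?_, ?_⟩, h3, fun x hx => h4 x hx⟩
    · rw [h3 _ (hb x₀ le_rfl hx₀).le, h1]
    · rw [h3 _ le_rfl, h2]
  choose F hF1 hF2 using step
  let s : ℕ → {α : ℝ ≃o ℝ // α x₀ = y₀ ∧ α (b x₀) = g y₀} := fun k => F^[k] ⟨a, ha, hab⟩
  have hs1 (k : ℕ) (x : ℝ) (hx : x ≤ b x₀) : (s (k + 1)).1 x = (s k).1 x := by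
    simp only [s, Function.iterate_succ_apply']
    exact hF1 _ x hx
  have hs2 (k : ℕ) (x : ℝ) (hx : b x₀ ≤ x) : (s (k + 1)).1 x = g ((s k).1 (b.symm x)) := by
    simp only [s, Function.iterate_succ_apply']
    exact hF2 _ x hx
  have hlt : ∀ k : ℕ, b^[k] x₀ < m ∧ x₀ ≤ b^[k] x₀ := by
    intro k
    induction k with
    | zero => exact ⟨hx₀, le_rfl⟩
    | succ k ih =>
      rw [Function.iterate_succ_apply']
      exact ⟨hbm ▸ b.strictMono ih.1, ih.2.trans (hb _ ih.2 ih.1).le⟩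
  have hmono : Monotone fun k : ℕ => b^[k] x₀ := monotone_nat_of_le_succ fun k => by
    rw [Function.iterate_succ_apply']
    exact (hb _ (hlt k).2 (hlt k).1).le
  have hglt : ∀ k : ℕ, g^[k] y₀ < m := by
    intro k
    induction k with
    | zero => exact hy₀
    | succ k ih =>
      rw [Function.iterate_succ_apply']
      exact hgm ▸ g.strictMono ih
  have hstab1 : ∀ k : ℕ, ∀ x ≤ b^[k + 1] x₀, (s (k + 1)).1 x = (s k).1 x := by
    intro k
    induction k with
    | zero => exact hs1 0
    | succ k ih =>
      intro x hx
      rcases le_total x (b x₀) with h | h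
      · exact hs1 _ x h
      · rw [hs2 _ x h, hs2 _ x h, ih]
        rw [b.symm_apply_le, ← Function.iterate_succ_apply' (f := b)]
        exact hx
  have hstab : ∀ k j : ℕ, k ≤ j → ∀ x ≤ b^[k] x₀, (s j).1 x = (s k).1 x := by
    intro k j hkj
    induction j, hkj using Nat.le_induction with
    | base => exact fun _ _ => rfl
    | succ j hkj ih =>
      intro x hx
      rw [hstab1 j x (hx.trans (hmono (hkj.trans j.le_succ))), ih x hx]
  have hend : ∀ k : ℕ, (s k).1 (b^[k] x₀) = g^[k] y₀ := by
    intro k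
    induction k with
    | zero => exact ha
    | succ k ih =>
      have : b x₀ ≤ b^[k + 1] x₀ := hmono (Nat.le_add_left 1 k)
      rw [hs2 k _ this, Function.iterate_succ_apply', Function.iterate_succ_apply',
        b.symm_apply_apply, ih]
  have hK : ∀ x < m, ∃ k : ℕ, x < b^[k] x₀ := fun x hx => exists_lt_iterate hx₀ hbm hb hx
  classical
  -- The stable value below `m`, the identity above. Since `b^[k] x₀` goes to `g^[k] y₀` and both
  -- orbits tend to `m`, the result is an increasing bijection.
  let f : ℝ → ℝ := fun x => if h : x < m then (s (Nat.find (hK x h))).1 x else x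
  have hf : ∀ k : ℕ, ∀ x ≤ b^[k] x₀, f x = (s k).1 x := by
    intro k x hx
    have hxm : x < m := hx.trans_lt (hlt k).1
    simp only [f, dif_pos hxm]
    rcases le_total k (Nat.find (hK x hxm)) with h | h
    · exact hstab _ _ h x hx
    · exact (hstab _ _ h x (Nat.find_spec (hK x hxm)).le).symm
  have hf' : ∀ x, m ≤ x → f x = x := fun x hx => by simp only [f, dif_neg (not_lt.2 hx)]
  have hfm : StrictMono f := by
    intro x y hxy
    rcases lt_or_ge y m with hy | hy
    · obtain ⟨k, hk⟩ := hK y hy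
      rw [hf k y hk.le, hf k x (hxy.trans hk).le]
      exact (s k).1.strictMono hxy
    · rw [hf' y hy]
      rcases lt_or_ge x m with hx | hx
      · obtain ⟨k, hk⟩ := hK x hx
        rw [hf k x hk.le]
        refine lt_of_lt_of_le ?_ hy
        refine lt_trans ((s k).1.strictMono hk) ?_
        rw [hend]
        exact hglt k
      · rwa [hf' x hx]
  have hfs : Function.Surjective f := by
    intro y
    rcases lt_or_ge y m with hy | hy
    · obtain ⟨k, hk⟩ := exists_lt_iterate hy₀ hgm hg hy
      refine ⟨(s k).1.symm y, ?_⟩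
      rw [hf k, OrderIso.apply_symm_apply]
      rw [OrderIso.symm_apply_le, hend]
      exact hk.le
    · exact ⟨y, hf' y hy⟩
  obtain ⟨a', ha'⟩ := exists_orderIso_of_strictMono hfm hfs
  refine ⟨a', fun x hx => by rw [ha', hf 1 x hx]; exact hs1 0 x hx,
    by rw [ha', hf' m le_rfl], fun x hx hxm => ?_⟩
  rcases hxm.eq_or_lt with rfl | hxm
  · rw [hbm, ha', hf' x le_rfl, hgm]
  · obtain ⟨k, hk⟩ := hK x hxm
    have h1 : b x ≤ b^[k + 1] x₀ := by
      rw [Function.iterate_succ_apply']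
      exact b.monotone hk.le
    rw [ha', ha', hf (k + 1) _ h1, hf k x hk.le, hs2 k _ (b.monotone hx), b.symm_apply_apply]

/-- Conjugating `b` to `g` is conjugating their inverses, which move points to the right. The
fundamental domain is then `[b x₀, x₀]`, so `a` is kept only up to `x₀`. -/
theorem exists_conj_of_gt {a b g : ℝ ≃o ℝ} {x₀ y₀ m : ℝ} (hx₀ : x₀ < m) (hy₀ : y₀ < m)
    (hbm : b m = m) (hgm : g m = m) (hb : ∀ x, x₀ ≤ x → x < m → b x < x)
    (hg : ∀ y, y₀ ≤ y → y < m → g y < y) (ha : a x₀ = y₀) (hab : a (b x₀) = g y₀) :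
    ∃ a' : ℝ ≃o ℝ, (∀ x ≤ x₀, a' x = a x) ∧ a' m = m ∧
      ∀ x, x₀ ≤ x → x ≤ m → a' (b x) = g (a' x) := by
  have hinv : ∀ {e : ℝ ≃o ℝ} {z : ℝ}, e m = m → (∀ x, z ≤ x → x < m → e x < x) →
      ∀ x, e z ≤ x → x < m → x < e.symm x := by
    intro e z hem he x hx hxm
    have h1 : z ≤ e.symm x := e.le_symm_apply.2 hx
    have h2 : e.symm x < m := by rwa [e.symm_apply_lt, hem]
    simpa using he _ h1 h2
  obtain ⟨a', h1, h2, h3⟩ := exists_conj_of_lt (a := a) (b := b.symm) (g := g.symm) (m := m)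
    (x₀ := b x₀) (y₀ := g y₀) ((hb x₀ le_rfl hx₀).trans hx₀) ((hg y₀ le_rfl hy₀).trans hy₀)
    (by rw [b.symm_apply_eq, hbm]) (by rw [g.symm_apply_eq, hgm]) (hinv hbm hb) (hinv hgm hg)
    hab (by simpa using ha)
  refine ⟨a', fun x hx => h1 x (by simpa using hx), h2, fun x hx hxm => ?_⟩
  have h4 := h3 (b x) (b.monotone hx) (by simpa [hbm] using b.monotone hxm)
  rw [b.symm_apply_apply, eq_comm, g.symm_apply_eq] at h4
  exact h4

/-- The conjugate of an increasing homeomorphism by `x ↦ -x`. -/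
def reflect (e : ℝ ≃o ℝ) : ℝ ≃o ℝ where
  toFun x := -e (-x)
  invFun x := -e.symm (-x)
  left_inv x := by simp
  right_inv x := by simp
  map_rel_iff' := by simp

theorem reflect_apply (e : ℝ ≃o ℝ) (x : ℝ) : reflect e x = -e (-x) := rfl

/-- Inverting makes the maps push left, and reflecting makes them push right again, with the end `n`
becoming the upper end `-n`. -/
theorem exists_conj_left {a b g : ℝ ≃o ℝ} {x₀ y₀ n : ℝ} (hx₀ : n < x₀) (hy₀ : n < y₀)
    (hbn : b n = n) (hgn : g n = n) (hb : ∀ x, n < x → x ≤ x₀ → x < b x)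
    (hg : ∀ y, n < y → y ≤ y₀ → y < g y) (ha : a x₀ = y₀) (hab : a (b.symm x₀) = g.symm y₀) :
    ∃ a' : ℝ ≃o ℝ, (∀ x, b.symm x₀ ≤ x → a' x = a x) ∧ a' n = n ∧
      ∀ x, n ≤ x → x ≤ b.symm x₀ → a' (b x) = g (a' x) := by
  have hinv : ∀ {e : ℝ ≃o ℝ} {z : ℝ}, e n = n → (∀ x, n < x → x ≤ z → x < e x) →
      ∀ x, n < x → x ≤ z → e.symm x < x := by
    intro e z hen he x hx hxz
    have h1 : n < e.symm x := by rwa [e.lt_symm_apply, hen]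
    rcases le_total (e.symm x) z with h2 | h2
    · simpa using he _ h1 h2
    · rcases h2.eq_or_lt with h3 | h3
      · have := he z (h3 ▸ h1) le_rfl
        rw [h3, e.apply_symm_apply] at this
        linarith
      · have h4 := e.strictMono (hxz.trans_lt h3)
        rw [e.apply_symm_apply] at h4
        exact absurd (he x hx hxz) (not_lt.2 h4.le)
  obtain ⟨a', h1, h2, h3⟩ := exists_conj_of_lt (a := reflect a) (b := reflect b.symm)
    (g := reflect g.symm) (m := -n) (x₀ := -x₀) (y₀ := -y₀) (by linarith) (by linarith)
    (by rw [reflect_apply, neg_neg, b.symm_apply_eq.2 hbn.symm])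
    (by rw [reflect_apply, neg_neg, g.symm_apply_eq.2 hgn.symm])
    (fun x hx hxn => by
      have := hinv hbn hb (-x) (by linarith) (by linarith)
      rw [reflect_apply]
      linarith)
    (fun x hx hxn => by
      have := hinv hgn hg (-x) (by linarith) (by linarith)
      rw [reflect_apply]
      linarith)
    (by simp [reflect_apply, ha]) (by simp [reflect_apply, hab])
  refine ⟨reflect a', fun x hx => ?_, by simp [reflect_apply, h2], fun x hx hxx => ?_⟩
  · rw [reflect_apply, h1 (-x) (by simpa [reflect_apply] using hx), reflect_apply]
    simp
  · have h4 := h3 (-(b x)) (by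
      have := b.monotone hxx
      rw [b.apply_symm_apply] at this
      linarith) (by
      have := b.monotone hx
      rw [hbn] at this
      linarith)
    rw [reflect_apply, neg_neg, b.symm_apply_apply, reflect_apply, eq_neg_iff_add_eq_zero] at h4
    rw [reflect_apply, reflect_apply, ← g.symm_apply_eq]
    linarith

end LineOrderIso

end

/-! ### Extending solutions of the commutator equation. -/

noncomputable section

open Set

section Commutator

/-- Both inequalities say `b' > φ` for `φ = max id f⁻¹`. Follow `φ` by the affine contraction
towards `m` whose slope makes the value at `n` equal to `b n`. -/
theorem exists_extend_above {b f : ℝ ≃o ℝ} {n m : ℝ} (hn : n < m) (hv : b n < m) (hf : f m = m)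
    (h1 : n < b n) (h2 : n < f (b n)) :
    ∃ b' : ℝ ≃o ℝ, (∀ x ≤ n, b' x = b x) ∧ b' m = m ∧
      ∀ x, n ≤ x → x < m → x < b' x ∧ x < f (b' x) := by
  obtain ⟨φ, hφ⟩ := exists_orderIso_max (OrderIso.refl ℝ) f.symm
  have hfm : f.symm m = m := by rw [f.symm_apply_eq, hf]
  have hφm : φ m = m := by simp [hφ, hfm]
  have hφn : φ n < b n := by
    rw [hφ]
    exact max_lt h1 (f.symm_apply_lt.2 h2)
  have h3 : 0 < m - φ n := by linarith
  have h4 : 0 < (m - b n) / (m - φ n) := div_pos (by linarith) h3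
  have h5 : (m - b n) / (m - φ n) < 1 := by
    rw [div_lt_one h3]
    linarith
  obtain ⟨l, hl⟩ := exists_orderIso_affine m m h4
  obtain ⟨b', hb1, hb2⟩ := exists_orderIso_glue b (φ.trans l) (p := n) (by
    rw [OrderIso.trans_apply, hl]
    field_simp
    ring)
  refine ⟨b', hb1, ?_, fun x hx hxm => ?_⟩
  · rw [hb2 m hn.le, OrderIso.trans_apply, hl, hφm]
    ring
  · have h6 : φ x < m := hφm ▸ φ.strictMono hxm
    have h7 : φ x < b' x := by
      rw [hb2 x hx, OrderIso.trans_apply, hl]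
      nlinarith
    have h8 : x ≤ φ x := by simp [hφ]
    have h9 : f.symm x ≤ φ x := by simp [hφ]
    exact ⟨h8.trans_lt h7, (f.symm_apply_lt).1 (h9.trans_lt h7)⟩

/-- The mirror construction, with `φ = min id f⁻¹` followed by an affine expansion away from `m`. -/
theorem exists_extend_below {b f : ℝ ≃o ℝ} {n m : ℝ} (hn : n < m) (hf : f m = m)
    (h1 : b n < n) (h2 : f (b n) < n) :
    ∃ b' : ℝ ≃o ℝ, (∀ x ≤ n, b' x = b x) ∧ b' m = m ∧
      ∀ x, n ≤ x → x < m → b' x < x ∧ f (b' x) < x := by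
  obtain ⟨φ, hφ⟩ := exists_orderIso_min (OrderIso.refl ℝ) f.symm
  have hfm : f.symm m = m := by rw [f.symm_apply_eq, hf]
  have hφm : φ m = m := by simp [hφ, hfm]
  have hφn : b n < φ n := by
    rw [hφ]
    exact lt_min h1 (f.lt_symm_apply.2 h2)
  have h3 : 0 < m - φ n := sub_pos.2 (hφm ▸ φ.strictMono hn)
  have h4 : 1 < (m - b n) / (m - φ n) := by
    rw [one_lt_div h3]
    linarith
  obtain ⟨l, hl⟩ := exists_orderIso_affine m m (one_pos.trans h4)
  obtain ⟨b', hb1, hb2⟩ := exists_orderIso_glue b (φ.trans l) (p := n) (by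
    rw [OrderIso.trans_apply, hl]
    field_simp
    ring)
  refine ⟨b', hb1, ?_, fun x hx hxm => ?_⟩
  · rw [hb2 m hn.le, OrderIso.trans_apply, hl, hφm]
    ring
  · have h6 : φ x < m := hφm ▸ φ.strictMono hxm
    have h7 : b' x < φ x := by
      rw [hb2 x hx, OrderIso.trans_apply, hl]
      nlinarith
    have h8 : φ x ≤ x := by simp [hφ]
    have h9 : φ x ≤ f.symm x := by simp [hφ]
    exact ⟨h7.trans_le h8, (f.lt_symm_apply).1 (h7.trans_le h9)⟩

/-- A solution of `a b = f b a` on a half-line, with `b` moving all points of `[x₀, n₁]`, can be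
changed above `x₀` so that it solves the equation up to a given fixed point `m` of `f`. -/
theorem exists_commutator_extend {a b f : ℝ ≃o ℝ} {x₀ n₁ m : ℝ} (h0 : x₀ ≤ n₁) (ha : a x₀ ≤ n₁)
    (ha' : a.symm x₀ ≤ n₁)
    (hb : (∀ x, x₀ ≤ x → x ≤ n₁ → x < b x) ∨ ∀ x, x₀ ≤ x → x ≤ n₁ → b x < x)
    (hrel : ∀ x ≤ n₁, a (b x) = f (b (a x))) (hf : f m = m) (hm : n₁ < m) (hbm : b n₁ < m) :
    ∃ a' b' : ℝ ≃o ℝ, (∀ x ≤ x₀, a' x = a x) ∧ (∀ x ≤ x₀, b' x = b x) ∧ a' m = m ∧ b' m = m ∧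
      (∀ x, x₀ ≤ x → x < m → b' x ≠ x) ∧ ∀ x ≤ m, a' (b' x) = f (b' (a' x)) := by
  have hn : max x₀ (a x₀) ≤ n₁ := max_le h0 ha
  -- On these points `f b` is the conjugate of `b` by `a`, so it moves them in the same direction as
  -- `b`. Beyond `max x₀ (a x₀)` the map `b` may be redefined.
  have hpre : ∀ y, a x₀ ≤ y → y ≤ max x₀ (a x₀) → ∃ z, x₀ ≤ z ∧ z ≤ n₁ ∧ a z = y := by
    intro y hy hy'
    refine ⟨a.symm y, a.le_symm_apply.2 hy, ?_, a.apply_symm_apply y⟩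
    rw [a.symm_apply_le]
    refine hy'.trans (max_le ?_ (a.monotone h0))
    rwa [← a.symm_apply_le]
  obtain ⟨n, hnd⟩ : ∃ n, n = max x₀ (a x₀) := ⟨_, rfl⟩
  rw [← hnd] at hn hpre
  have hxn : x₀ ≤ n := hnd ▸ le_max_left _ _
  have hyn : a x₀ ≤ n := hnd ▸ le_max_right _ _
  rcases hb with hb | hb
  · have hfb : ∀ y, a x₀ ≤ y → y ≤ n → y < f (b y) := by
      intro y hy hy'
      obtain ⟨z, hz, hz', rfl⟩ := hpre y hy hy'
      rw [← hrel z hz']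
      exact a.strictMono (hb z hz hz')
    obtain ⟨b', h1, h2, h3⟩ := exists_extend_above (b := b) (f := f) (n := n) (m := m)
      (hn.trans_lt hm) ((b.monotone hn).trans_lt hbm) hf (hb n hxn hn) (hfb n hyn le_rfl)
    have hbx : ∀ x, x₀ ≤ x → x < m → x < b' x := by
      intro x hx hxm
      rcases le_total x n with h | h
      · rw [h1 x h]
        exact hb x hx (h.trans hn)
      · exact (h3 x h hxm).1
    obtain ⟨a', h4, h5, h6⟩ := exists_conj_of_lt (a := a) (b := b') (g := b'.trans f) (m := m)
      (h0.trans_lt hm) (ha.trans_lt hm) h2 (by simp [h2, hf]) hbx (fun y hy hym => by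
        rcases le_total y n with h | h
        · rw [OrderIso.trans_apply, h1 y h]
          exact hfb y hy h
        · exact (h3 y h hym).2) rfl (by
        rw [OrderIso.trans_apply, h1 x₀ hxn, h1 _ hyn, hrel x₀ h0])
    have hlt : x₀ < b' x₀ := hbx x₀ le_rfl (h0.trans_lt hm)
    refine ⟨a', b', fun x hx => h4 x (hx.trans hlt.le), fun x hx => h1 x (hx.trans hxn), h5, h2,
      fun x hx hxm => (hbx x hx hxm).ne', fun x hxm => ?_⟩
    rcases le_total x x₀ with h | h
    · rw [h4 _ (b'.monotone h), h4 x (h.trans hlt.le), h1 x (h.trans hxn),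
        h1 _ ((a.monotone h).trans hyn), hrel x (h.trans h0)]
    · exact h6 x h hxm
  · have hfb : ∀ y, a x₀ ≤ y → y ≤ n → f (b y) < y := by
      intro y hy hy'
      obtain ⟨z, hz, hz', rfl⟩ := hpre y hy hy'
      rw [← hrel z hz']
      exact a.strictMono (hb z hz hz')
    obtain ⟨b', h1, h2, h3⟩ := exists_extend_below (b := b) (f := f) (n := n) (m := m)
      (hn.trans_lt hm) hf (hb n hxn hn) (hfb n hyn le_rfl)
    have hbx : ∀ x, x₀ ≤ x → x < m → b' x < x := by
      intro x hx hxm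
      rcases le_total x n with h | h
      · rw [h1 x h]
        exact hb x hx (h.trans hn)
      · exact (h3 x h hxm).1
    obtain ⟨a', h4, h5, h6⟩ := exists_conj_of_gt (a := a) (b := b') (g := b'.trans f) (m := m)
      (h0.trans_lt hm) (ha.trans_lt hm) h2 (by simp [h2, hf]) hbx (fun y hy hym => by
        rcases le_total y n with h | h
        · rw [OrderIso.trans_apply, h1 y h]
          exact hfb y hy h
        · exact (h3 y h hym).2) rfl (by
        rw [OrderIso.trans_apply, h1 x₀ hxn, h1 _ hyn, hrel x₀ h0])
    have hlt : b' x₀ < x₀ := hbx x₀ le_rfl (h0.trans_lt hm)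
    refine ⟨a', b', h4, fun x hx => h1 x (hx.trans hxn), h5, h2,
      fun x hx hxm => (hbx x hx hxm).ne, fun x hxm => ?_⟩
    rcases le_total x x₀ with h | h
    · rw [h4 _ ((b'.monotone h).trans hlt.le), h4 x h, h1 x (h.trans hxn),
        h1 _ ((a.monotone h).trans hyn), hrel x (h.trans h0)]
    · exact h6 x h hxm

/-- Every increasing homeomorphism of `[n, m]` is a commutator. -/
theorem exists_commutator_Icc {f : ℝ ≃o ℝ} {n m : ℝ} (hnm : n < m) (hn : f n = n) (hm : f m = m) :
    ∃ a b : ℝ ≃o ℝ, a n = n ∧ b n = n ∧ a m = m ∧ b m = m ∧ (∀ x, n < x → x < m → b x ≠ x) ∧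
      ∀ x, n ≤ x → x ≤ m → a (b x) = f (b (a x)) := by
  -- If `b` exceeds `φ` on `(n, m)`, then `b` and `f b` both push points to the right there, hence
  -- are conjugate.
  obtain ⟨φ, hφ⟩ := exists_orderIso_max (OrderIso.refl ℝ) f.symm
  have hφm : φ m = m := by simp [hφ, (f.symm_apply_eq).2 hm.symm]
  have hφn : φ n = n := by simp [hφ, (f.symm_apply_eq).2 hn.symm]
  obtain ⟨l₁, hl₁⟩ := exists_orderIso_affine n n (s := 2) two_pos
  obtain ⟨l₂, hl₂⟩ := exists_orderIso_affine m m (s := 1 / 2) (by norm_num)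
  -- Slope `2` at `n` and slope `1 / 2` at `m`: `θ` fixes both ends and lies above the identity
  -- between them.
  obtain ⟨θ, hθ⟩ := exists_orderIso_min l₁ l₂
  have hθn : θ n = n := by
    rw [hθ, hl₁, hl₂, min_eq_left (by linarith)]
    ring
  have hθm : θ m = m := by
    rw [hθ, hl₁, hl₂, min_eq_right (by linarith)]
    ring
  have hθx : ∀ x, n < x → x < m → x < θ x := fun x h1 h2 => by
    rw [hθ, hl₁, hl₂]
    exact lt_min (by linarith) (by linarith)
  obtain ⟨b, hb⟩ : ∃ b, b = φ.trans θ := ⟨_, rfl⟩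
  have hbn : b n = n := by rw [hb, OrderIso.trans_apply, hφn, hθn]
  have hbm : b m = m := by rw [hb, OrderIso.trans_apply, hφm, hθm]
  have hbφ : ∀ x, n < x → x < m → φ x < b x := fun x h1 h2 => by
    rw [hb]
    exact hθx _ (hφn ▸ φ.strictMono h1) (hφm ▸ φ.strictMono h2)
  have hbx : ∀ x, n < x → x < m → x < b x := fun x h1 h2 =>
    lt_of_le_of_lt (by simp [hφ]) (hbφ x h1 h2)
  obtain ⟨g, hg⟩ : ∃ g, g = b.trans f := ⟨_, rfl⟩
  have hga : ∀ x, g x = f (b x) := fun x => by rw [hg]; rfl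
  have hgn : g n = n := by rw [hga, hbn, hn]
  have hgm : g m = m := by rw [hga, hbm, hm]
  have hgx : ∀ x, n < x → x < m → x < g x := fun x h1 h2 => by
    rw [hga, ← f.symm_apply_lt]
    exact lt_of_le_of_lt (by simp [hφ]) (hbφ x h1 h2)
  obtain ⟨c, hc, hc'⟩ := exists_between hnm
  have hb1 : n < b.symm c := by rwa [b.lt_symm_apply, hbn]
  have hb3 : b.symm c < m := by rwa [b.symm_apply_lt, hbm]
  have hb2 : b.symm c < c := by simpa using hbx _ hb1 hb3
  have hg1 : n < g.symm c := by rwa [g.lt_symm_apply, hgn]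
  have hg3 : g.symm c < m := by rwa [g.symm_apply_lt, hgm]
  have hg2 : g.symm c < c := by simpa using hgx _ hg1 hg3
  have hbc : c - b.symm c ≠ 0 := (sub_pos.2 hb2).ne'
  -- The affine map from the fundamental domain `[b⁻¹ c, c]` to `[g⁻¹ c, c]`; it is then propagated
  -- to the left and to the right.
  obtain ⟨a₀, ha₀⟩ := exists_orderIso_affine c c (div_pos (sub_pos.2 hg2) (sub_pos.2 hb2))
  have ha₁ : a₀ (b.symm c) = g.symm c := by
    rw [ha₀]
    field_simp
    ring
  obtain ⟨a₁, h1, h2, h3⟩ := exists_conj_left (a := a₀) (b := b) (g := g) hc hc hbn hgn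
    (fun x h h' => hbx x h (h'.trans_lt hc')) (fun x h h' => hgx x h (h'.trans_lt hc'))
    (by simp [ha₀]) ha₁
  obtain ⟨a, h4, h5, h6⟩ := exists_conj_of_lt (a := a₁) (b := b) (g := g) hb3 hg3 hbm hgm
    (fun x h h' => hbx x (hb1.trans_le h) h') (fun x h h' => hgx x (hg1.trans_le h) h')
    ((h1 _ le_rfl).trans ha₁) (by simp [h1 c hb2.le, ha₀])
  rw [b.apply_symm_apply] at h4
  refine ⟨a, b, (h4 n hc.le).trans h2, hbn, h5, hbm, fun x h h' => (hbx x h h').ne',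
    fun x hx hxm => ?_⟩
  rw [← hga]
  rcases le_total x (b.symm c) with h | h
  · rw [h4 _ (b.le_symm_apply.1 h), h4 _ (h.trans hb2.le), h3 x hx h]
  · exact h6 x h hxm

theorem lt_or_gt_of_forall_ne {b : ℝ ≃o ℝ} {N : ℝ} (h : ∀ x, N ≤ x → b x ≠ x) :
    (∀ x, N ≤ x → x < b x) ∨ ∀ x, N ≤ x → b x < x := by
  have hc : ContinuousOn (fun x => b x - x) (Ici N) :=
    (b.continuous.sub continuous_id).continuousOn
  by_contra! hcon
  obtain ⟨⟨x, hx, hx'⟩, y, hy, hy'⟩ := hcon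
  obtain ⟨z, hz, hz'⟩ := isPreconnected_Ici.intermediate_value (mem_Ici.2 hx) (mem_Ici.2 hy) hc
    (show (0 : ℝ) ∈ Icc (b x - x) (b y - y) from ⟨by linarith, by linarith⟩)
  exact h z hz (sub_eq_zero.1 hz')

/-- A pair `a, b` can be changed far to the right so that its commutator becomes any prescribed
extension of its commutator on a left half-line, up to a fixed point `m` of the latter. -/
theorem exists_commutator_extend_far (a b : ℝ ≃o ℝ) (N : ℝ) :
    ∃ n' : ℝ, ∀ (f : ℝ ≃o ℝ) (m : ℝ), n' < m → f m = m →
      (∀ x ≤ n', a (b x) = f (b (a x))) →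
      ∃ (a' b' : ℝ ≃o ℝ) (n : ℝ), N ≤ n ∧ n ≤ n' ∧ (∀ x ≤ n, a' x = a x) ∧ (∀ x ≤ n, b' x = b x) ∧
        (∀ x, n < x → x < m → a' x ≠ x ∨ b' x ≠ x) ∧ a' m = m ∧ b' m = m ∧
        ∀ x ≤ m, a' (b' x) = f (b' (a' x)) := by
  -- If `a` and `b` share a fixed point `n`, then `f` fixes it too and any solution on `[n, m]` can
  -- be glued. If only `b` fixes `n`, the roles are exchanged: `b a = f⁻¹ a b`, where `a` moves the
  -- one-point interval `[n, n]`. If `b` has no fixed point beyond `N`, it pushes everything there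
  -- in one direction.
  by_cases hB : ∃ n ≥ N, b n = n
  · obtain ⟨n, hN, hbn⟩ := hB
    by_cases han : a n = n
    · refine ⟨n, fun f m hnm hfm hrel => ?_⟩
      have hfn : f n = n := by simpa [hbn, han] using (hrel n le_rfl).symm
      obtain ⟨a₂, b₂, h1, h2, h3, h4, h5, h6⟩ := exists_commutator_Icc hnm hfn hfm
      obtain ⟨a', ha1, ha2⟩ := exists_orderIso_glue a a₂ (han.trans h1.symm)
      obtain ⟨b', hb1, hb2⟩ := exists_orderIso_glue b b₂ (hbn.trans h2.symm)
      refine ⟨a', b', n, hN, le_rfl, ha1, hb1, fun x hx hxm => Or.inr ?_, by rw [ha2 m hnm.le, h3],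
        by rw [hb2 m hnm.le, h4], fun x hx => ?_⟩
      · rw [hb2 x hx.le]
        exact h5 x hx hxm
      · rcases le_total x n with h | h
        · have h7 : b x ≤ n := hbn ▸ b.monotone h
          have h8 : a x ≤ n := han ▸ a.monotone h
          rw [hb1 x h, ha1 _ h7, ha1 x h, hb1 _ h8, hrel x h]
        · have h7 : n ≤ b₂ x := by simpa [h2] using b₂.monotone h
          have h8 : n ≤ a₂ x := by simpa [h1] using a₂.monotone h
          rw [hb2 x h, ha2 _ h7, ha2 x h, hb2 _ h8, h6 x h hx]
    · refine ⟨max n (a n), fun f m hnm hfm hrel => ?_⟩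
      obtain ⟨b', a', h1, h2, h3, h4, h5, h6⟩ := exists_commutator_extend (a := b) (b := a)
        (f := f.symm) (x₀ := n) (n₁ := n) (m := m) le_rfl hbn.le (by simp [hbn, b.symm_apply_le])
        (by
          rcases lt_or_gt_of_ne han with h | h
          · exact Or.inr fun x hx hx' => by rwa [le_antisymm hx' hx]
          · exact Or.inl fun x hx hx' => by rwa [le_antisymm hx' hx])
        (fun x hx => by rw [hrel x (hx.trans (le_max_left _ _)), f.symm_apply_apply])
        (by rw [f.symm_apply_eq, hfm]) ((le_max_left _ _).trans_lt hnm)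
        ((le_max_right _ _).trans_lt hnm)
      exact ⟨a', b', n, hN, le_max_left _ _, h2, h1, fun x hx hxm => Or.inl (h5 x hx.le hxm), h4,
        h3, fun x hx => by rw [h6 x hx, f.apply_symm_apply]⟩
  · push Not at hB
    obtain ⟨n₁, h1, h2, h3⟩ : ∃ n₁, N ≤ n₁ ∧ a N ≤ n₁ ∧ a.symm N ≤ n₁ :=
      ⟨max N (max (a N) (a.symm N)), by simp, by simp, by simp⟩
    refine ⟨max n₁ (b n₁), fun f m hnm hfm hrel => ?_⟩
    obtain ⟨a', b', h4, h5, h6, h7, h8, h9⟩ := exists_commutator_extend (a := a) (b := b)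
      (f := f) (m := m) h1 h2 h3 ((lt_or_gt_of_forall_ne hB).imp (fun h x hx _ => h x hx)
        fun h x hx _ => h x hx) (fun x hx => hrel x (hx.trans (le_max_left _ _))) hfm
      ((le_max_left _ _).trans_lt hnm) ((le_max_right _ _).trans_lt hnm)
    exact ⟨a', b', N, le_rfl, h1.trans (le_max_left _ _), h4, h5,
      fun x hx hxm => Or.inr (h8 x hx.le hxm), h6, h7, h9⟩

end Commutator

end

/-! ### Cutting and gluing solutions of the surface relation. -/

noncomputable section

open Set

section SurfaceTuples

theorem commutator_apply (u w : ℝ ≃o ℝ) (t : ℝ) :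
    (w * u * w⁻¹ * u⁻¹) (u (w t)) = w (u t) := by
  simp [RelIso.mul_apply]

/-- Writing the argument as `u (w t)` removes the inverses: only the values of the letters at `t`,
`w t` and `u t` matter. -/
theorem commutator_apply_congr {u w u' w' : ℝ ≃o ℝ} {t : ℝ} (h1 : w' t = w t)
    (h2 : u' (w t) = u (w t)) (h3 : u' t = u t) (h4 : w' (u t) = w (u t)) :
    (w' * u' * w'⁻¹ * u'⁻¹) (u (w t)) = (w * u * w⁻¹ * u⁻¹) (u (w t)) := by
  rw [commutator_apply, ← h2, ← h1, commutator_apply, h3, h4]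

theorem exists_eq_apply_apply (u w : ℝ ≃o ℝ) (x : ℝ) : ∃ t, x = u (w t) :=
  ⟨w.symm (u.symm x), by simp⟩

/-- The bounds `m'` and `m` are separate because `u` may be a translation carrying `m'` to `m`. -/
theorem commutator_congr_Iic {u w u' w' : ℝ ≃o ℝ} {m m' : ℝ} (hu : u m' = m) (hw' : w m' = m')
    (hw : w m = m) (h1 : ∀ x ≤ m', u' x = u x) (h2 : ∀ x ≤ m', w' x = w x)
    (h3 : ∀ x ≤ m, w' x = w x) (x : ℝ) (hx : x ≤ m) :
    (w' * u' * w'⁻¹ * u'⁻¹) x = (w * u * w⁻¹ * u⁻¹) x ∧ (w * u * w⁻¹ * u⁻¹) x ≤ m := by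
  obtain ⟨t, rfl⟩ := exists_eq_apply_apply u w x
  have h4 : w t ≤ m' := by rwa [← hu, u.le_iff_le] at hx
  have h5 : t ≤ m' := by rwa [← hw', w.le_iff_le] at h4
  have h6 : u t ≤ m := hu ▸ u.monotone h5
  refine ⟨commutator_apply_congr (h2 t h5) (h1 _ h4) (h1 t h5) (h3 _ h6), ?_⟩
  rw [commutator_apply]
  exact hw ▸ w.monotone h6

theorem commutator_congr_Ici {u w u' w' : ℝ ≃o ℝ} {m m' : ℝ} (hu : u m' = m) (hw' : w m' = m')
    (hw : w m = m) (h1 : ∀ x, m' ≤ x → u' x = u x) (h2 : ∀ x, m' ≤ x → w' x = w x)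
    (h3 : ∀ x, m ≤ x → w' x = w x) (x : ℝ) (hx : m ≤ x) :
    (w' * u' * w'⁻¹ * u'⁻¹) x = (w * u * w⁻¹ * u⁻¹) x ∧ m ≤ (w * u * w⁻¹ * u⁻¹) x := by
  obtain ⟨t, rfl⟩ := exists_eq_apply_apply u w x
  have h4 : m' ≤ w t := by rwa [← hu, u.le_iff_le] at hx
  have h5 : m' ≤ t := by rwa [← hw', w.le_iff_le] at h4
  have h6 : m ≤ u t := hu ▸ u.monotone h5
  refine ⟨commutator_apply_congr (h2 t h5) (h1 _ h4) (h1 t h5) (h3 _ h6), ?_⟩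
  rw [commutator_apply]
  exact hw ▸ w.monotone h6

theorem surfaceWord_congr_on {u w u' w' : ℕ → ℝ ≃o ℝ} {n : ℕ} {s : Set ℝ}
    (h : ∀ i < n, ∀ x ∈ s, (w' i * u' i * (w' i)⁻¹ * (u' i)⁻¹) x =
      (w i * u i * (w i)⁻¹ * (u i)⁻¹) x ∧ (w i * u i * (w i)⁻¹ * (u i)⁻¹) x ∈ s) :
    ∀ x ∈ s, surfaceWord u' w' n x = surfaceWord u w n x ∧ surfaceWord u w n x ∈ s := by
  induction n with
  | zero => exact fun x hx => ⟨rfl, hx⟩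
  | succ n ih =>
    intro x hx
    obtain ⟨h1, h2⟩ := ih (fun i hi => h i (hi.trans n.lt_succ_self)) x hx
    rw [surfaceWord, surfaceWord, RelIso.mul_apply, h1,
      RelIso.mul_apply _ (surfaceWord u w n)]
    exact h n n.lt_succ_self _ h2

theorem surfaceWord_apply_eq_self {u w : ℕ → ℝ ≃o ℝ} {n : ℕ} {x : ℝ}
    (h : ∀ i < n, (w i * u i * (w i)⁻¹ * (u i)⁻¹) x = x) : surfaceWord u w n x = x := by
  induction n with
  | zero => rfl
  | succ n ih =>
    rw [surfaceWord, RelIso.mul_apply, ih fun i hi => h i (hi.trans n.lt_succ_self)]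
    exact h n n.lt_succ_self

/-- The values of the surface word on a left half-line depend only on the values of the letters on
some left half-line. -/
theorem exists_surfaceWord_congr_Iic (u w : ℕ → ℝ ≃o ℝ) (n : ℕ) (N : ℝ) :
    ∃ M, ∀ u' w' : ℕ → ℝ ≃o ℝ, (∀ i < n, ∀ x ≤ M, u' i x = u i x ∧ w' i x = w i x) →
      ∀ x ≤ N, surfaceWord u' w' n x = surfaceWord u w n x := by
  induction n with
  | zero => exact ⟨0, fun _ _ _ _ _ => rfl⟩
  | succ n ih =>
    obtain ⟨M, hM⟩ := ih
    obtain ⟨t, ht⟩ := exists_eq_apply_apply (u n) (w n) (surfaceWord u w n N)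
    obtain ⟨K, h1, h2, h3, h4⟩ : ∃ K, M ≤ K ∧ t ≤ K ∧ w n t ≤ K ∧ u n t ≤ K :=
      ⟨max (max M t) (max (w n t) (u n t)), by simp, by simp, by simp, by simp⟩
    refine ⟨K, fun u' w' h x hx => ?_⟩
    rw [surfaceWord, surfaceWord, RelIso.mul_apply, RelIso.mul_apply _ (surfaceWord u w n),
      hM u' w' (fun i hi x hx => h i (hi.trans n.lt_succ_self) x (hx.trans h1)) x hx]
    have h5 := (surfaceWord u w n).monotone hx
    rw [ht] at h5
    obtain ⟨s, hs⟩ := exists_eq_apply_apply (u n) (w n) (surfaceWord u w n x)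
    rw [hs] at h5 ⊢
    have h6 : w n s ≤ w n t := (u n).le_iff_le.1 h5
    have h7 : s ≤ t := (w n).le_iff_le.1 h6
    have h8 := h n n.lt_succ_self
    exact commutator_apply_congr (h8 s (h7.trans h2)).2 (h8 _ (h6.trans h3)).1
      (h8 s (h7.trans h2)).1 (h8 _ (((u n).monotone h7).trans h4)).2

/-- The tuple satisfies the surface relation and has no common fixed point. -/
def IsSharpTuple (q : ℕ) (u w : ℕ → ℝ ≃o ℝ) : Prop :=
  surfaceWord u w q = 1 ∧ ∀ x, ∃ i < q, u i x ≠ x ∨ w i x ≠ x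

/-- Handles `0` to `p - 1` are brought to normal form near `m`, and handle `p` absorbs the effect on
the relation. The bound `ε ≤ 1` keeps `m - ε` in the region of the normal form. -/
theorem IsSharpTuple.exists_left {p : ℕ} (hp : 0 < p) {u w : ℕ → ℝ ≃o ℝ}
    (h : IsSharpTuple (p + 1) u w) {ε : ℝ} (hε : ε ≠ 0) (hε' : ε ≤ 1) (N : ℝ) :
    ∃ m > N, ∃ u' w' : ℕ → ℝ ≃o ℝ,
      (∀ i < p + 1, ∀ x ≤ N, u' i x = u i x ∧ w' i x = w i x) ∧
      (∀ x ≤ m, surfaceWord u' w' (p + 1) x = x) ∧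
      (∀ i < p + 1, i ≠ 0 → u' i m = m ∧ w' i m = m) ∧
      (∀ x, m - 1 ≤ x → u' 0 x = x + ε ∧ w' 0 x = x) ∧
      ∀ x ≤ m, ∃ i < p + 1, u' i x ≠ x ∨ w' i x ≠ x := by
  -- The threshold `n'` for the last handle is independent of `f`. This matters because `f` will be
  -- `W⁻¹`, and `W` depends on modifications of the other handles made beyond `n'`.
  obtain ⟨n', hn'⟩ := exists_commutator_extend_far (w p) (u p) N
  obtain ⟨M₀, hM₀⟩ := exists_surfaceWord_congr_Iic u w p (w p (u p n'))
  obtain ⟨M, hM, hnM⟩ : ∃ M, M₀ ≤ M ∧ n' ≤ M := ⟨max M₀ n', by simp, by simp⟩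
  obtain ⟨m, hmN, hmn, hmM, hm⟩ : ∃ m, N < m ∧ n' < m ∧ M + 1 < m ∧ ∀ i ∈ Finset.range p,
      u i M + 1 < m ∧ u i M + 1 - ε < m ∧ w i M + 1 < m :=
    -- The point `m` is so far out that each letter can climb from its value at `M` to its
    -- prescribed value at `m - 1`.
    ((Filter.eventually_gt_atTop N).and ((Filter.eventually_gt_atTop n').and
      ((Filter.eventually_gt_atTop (M + 1)).and ((Filter.eventually_all_finset _).2 fun i _ =>
        (Filter.eventually_gt_atTop _).and ((Filter.eventually_gt_atTop _).and
          (Filter.eventually_gt_atTop _)))))).exists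
  have hext : ∀ i, ∃ e : (ℝ ≃o ℝ) × (ℝ ≃o ℝ), i < p →
      (∀ x ≤ M, e.1 x = u i x ∧ e.2 x = w i x) ∧
      ∀ x, m - 1 ≤ x → e.1 x = x + (if i = 0 then ε else 0) ∧ e.2 x = x := by
    intro i
    by_cases hi : i < p
    · obtain ⟨h1, h2, h3⟩ := hm i (Finset.mem_range.2 hi)
      obtain ⟨e, he, he'⟩ := exists_orderIso_extend (u i) (M := M) (p := m - 1)
        (r := m - 1 + if i = 0 then ε else 0) (by linarith) (by split_ifs <;> linarith)
      obtain ⟨d, hd, hd'⟩ := exists_orderIso_extend (w i) (M := M) (p := m - 1)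
        (r := m - 1) (by linarith) (by linarith)
      refine ⟨(e, d), fun _ => ⟨fun x hx => ⟨he x hx, hd x hx⟩, fun x hx => ⟨?_, ?_⟩⟩⟩
      · rw [he' x hx]
        ring
      · rw [hd' x hx]
        ring
    · exact ⟨1, fun h => absurd h hi⟩
  choose e he using hext
  obtain ⟨W, hW⟩ : ∃ W, W = surfaceWord (fun i => (e i).1) (fun i => (e i).2) p := ⟨_, rfl⟩
  have hWm : W m = m := by
    rw [hW]
    refine surfaceWord_apply_eq_self fun i hi => ?_
    have h1 := (he i hi).2
    -- The commutator is evaluated at `m = u (w t)`, where `t` is the preimage of `m` under the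
    -- translation, or `m` itself.
    have h2 : (e i).2 (m - if i = 0 then ε else 0) = m - if i = 0 then ε else 0 :=
      (h1 _ (by split_ifs <;> linarith)).2
    have h3 : (e i).1 ((e i).2 (m - if i = 0 then ε else 0)) = m := by
      rw [h2, (h1 _ (by split_ifs <;> linarith)).1]
      ring
    have h4 := commutator_apply (e i).1 (e i).2 (m - if i = 0 then ε else 0)
    rw [h3] at h4
    rw [h4, (h1 _ (by split_ifs <;> linarith)).1, sub_add_cancel, (h1 _ (by linarith)).2]
  have hword : ∀ x, w p (u p x) = (surfaceWord u w p)⁻¹ (u p (w p x)) := by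
    intro x
    have h1 := h.1
    rw [surfaceWord, mul_eq_one_iff_eq_inv] at h1
    rw [← h1, commutator_apply]
  have hagree : ∀ x ≤ n', w p (u p x) = W.symm (u p (w p x)) := by
    intro x hx
    rw [W.eq_symm_apply, hW, hM₀ _ _ (fun i hi x hx => (he i hi).1 x (hx.trans hM)) _
      ((w p).monotone ((u p).monotone hx)), hword, RelIso.apply_inv_self]
  obtain ⟨a, b, n, hNn, hnn, ha, hb, hmov, ham, hbm, hrel⟩ := hn' W.symm m hmn
    (W.symm_apply_eq.2 hWm.symm) hagree
  have hnM' : ∀ x ≤ n, x ≤ M := fun x hx => hx.trans (hnn.trans hnM)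
  refine ⟨m, hmN, fun i => if i = p then b else (e i).1, fun i => if i = p then a else (e i).2,
    fun i hi x hx => ?_, fun x hx => ?_, fun i hi hi0 => ?_, fun x hx => ?_, fun x hx => ?_⟩
  · rcases (Nat.lt_succ_iff_lt_or_eq.1 hi) with hi | rfl
    · simpa [hi.ne] using (he i hi).1 x (hnM' x (hx.trans hNn))
    · simpa using ⟨hb x (hx.trans hNn), ha x (hx.trans hNn)⟩
  · rw [surfaceWord, RelIso.mul_apply, surfaceWord_congr (u' := fun i => (e i).1)
      (w' := fun i => (e i).2) (fun i hi => if_neg hi.ne) (fun i hi => if_neg hi.ne), ← hW]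
    simp only [if_true]
    obtain ⟨t, ht⟩ := exists_eq_apply_apply b a (W x)
    have h1 : b (a t) ≤ m := by
      rw [← ht]
      exact hWm ▸ W.monotone hx
    have h2 : t ≤ m := by
      rw [← hbm, b.le_iff_le] at h1
      rwa [← ham, a.le_iff_le] at h1
    rw [ht, commutator_apply, hrel t h2, ← ht, W.symm_apply_apply]
  · rcases (Nat.lt_succ_iff_lt_or_eq.1 hi) with hi | rfl
    · simpa [hi.ne, hi0] using (he i hi).2 m (by linarith)
    · simpa using ⟨hbm, ham⟩
  · simpa [hp.ne] using (he 0 hp).2 x hx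
  · rcases le_or_gt x n with hxn | hxn
    · obtain ⟨i, hi, hi'⟩ := h.2 x
      refine ⟨i, hi, ?_⟩
      rcases (Nat.lt_succ_iff_lt_or_eq.1 hi) with hi | rfl
      · simpa [hi.ne, (he i hi).1 x (hnM' x hxn)] using hi'
      · simpa [hb x hxn, ha x hxn] using hi'
    -- The point `m` is moved by the translation letter; between `n` and `m` the last handle has no
    -- common fixed point.
    · rcases hx.eq_or_lt with rfl | hx
      · exact ⟨0, p.succ_pos, Or.inl (by simpa [hp.ne, (he 0 hp).2 x (by linarith)] using hε)⟩
      · exact ⟨p, p.lt_succ_self, by simpa using (hmov x hxn hx).symm⟩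

/-- Conjugation by `x ↦ -x`. -/
def reflectHom : (ℝ ≃o ℝ) →* (ℝ ≃o ℝ) where
  toFun := reflect
  map_one' := by
    ext x
    simp [reflect_apply]
  map_mul' a b := by
    ext x
    simp [reflect_apply, RelIso.mul_apply]

theorem surfaceWord_reflect (u w : ℕ → ℝ ≃o ℝ) (n : ℕ) :
    surfaceWord (fun i => reflect (u i)) (fun i => reflect (w i)) n =
      reflect (surfaceWord u w n) :=
  (map_surfaceWord reflectHom u w n).symm

theorem IsSharpTuple.reflect {q : ℕ} {u w : ℕ → ℝ ≃o ℝ} (h : IsSharpTuple q u w) :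
    IsSharpTuple q (fun i => reflect (u i)) fun i => reflect (w i) := by
  refine ⟨by rw [surfaceWord_reflect, h.1]; exact map_one reflectHom, fun x => ?_⟩
  obtain ⟨i, hi, h2⟩ := h.2 (-x)
  refine ⟨i, hi, h2.imp (fun h3 h4 => h3 ?_) fun h3 h4 => h3 ?_⟩ <;>
  · rw [reflect_apply] at h4
    linarith

/-- The reflection of the left-hand case. Reflecting a translation changes its sign, which is why
both statements carry a signed `ε`. -/
theorem IsSharpTuple.exists_right {p : ℕ} (hp : 0 < p) {u w : ℕ → ℝ ≃o ℝ}
    (h : IsSharpTuple (p + 1) u w) {ε : ℝ} (hε : ε ≠ 0) (hε' : -1 ≤ ε) (N : ℝ) :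
    ∃ m < N, ∃ u' w' : ℕ → ℝ ≃o ℝ,
      (∀ i < p + 1, ∀ x, N ≤ x → u' i x = u i x ∧ w' i x = w i x) ∧
      (∀ x, m ≤ x → surfaceWord u' w' (p + 1) x = x) ∧
      (∀ i < p + 1, i ≠ 0 → u' i m = m ∧ w' i m = m) ∧
      (∀ x ≤ m + 1, u' 0 x = x + ε ∧ w' 0 x = x) ∧
      ∀ x, m ≤ x → ∃ i < p + 1, u' i x ≠ x ∨ w' i x ≠ x := by
  obtain ⟨m, hm, u', w', h1, h2, h3, h4, h5⟩ := h.reflect.exists_left hp (ε := -ε)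
    (by simpa using hε) (by linarith) (-N)
  refine ⟨-m, by linarith, fun i => _root_.reflect (u' i), fun i => _root_.reflect (w' i),
    fun i hi x hx => ?_, fun x hx => ?_, fun i hi hi0 => ?_, fun x hx => ?_, fun x hx => ?_⟩
  · simp [reflect_apply, h1 i hi (-x) (by linarith)]
  · rw [surfaceWord_reflect, reflect_apply, h2 (-x) (by linarith), neg_neg]
  · simp [reflect_apply, h3 i hi hi0]
  · simp [reflect_apply, h4 (-x) (by linarith), add_comm]
  · obtain ⟨i, hi, h6⟩ := h5 (-x) (by linarith)
    refine ⟨i, hi, h6.imp (fun h7 h8 => h7 ?_) fun h7 h8 => h7 ?_⟩ <;>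
    · rw [reflect_apply] at h8
      linarith

/-- The commutators preserve each half-line bounded by `m`, so the relation can be checked on each.
Letters other than `u 0` fix `m`; `u 0` crosses it, but both tuples agree in handle `0` on `[m - 1,
m + 1]`. -/
theorem exists_isSharpTuple_glue {q : ℕ} {u w u' w' : ℕ → ℝ ≃o ℝ} {m : ℝ}
    (h1 : ∀ x ≤ m, surfaceWord u w q x = x) (h1' : ∀ x, m ≤ x → surfaceWord u' w' q x = x)
    (h2 : ∀ i < q, i ≠ 0 → u i m = m ∧ w i m = m)
    (h2' : ∀ i < q, i ≠ 0 → u' i m = m ∧ w' i m = m)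
    (h3 : ∀ x, m - 1 ≤ x → u 0 x = x + 1 ∧ w 0 x = x)
    (h3' : ∀ x ≤ m + 1, u' 0 x = x + 1 ∧ w' 0 x = x)
    (h4 : ∀ x ≤ m, ∃ i < q, u i x ≠ x ∨ w i x ≠ x)
    (h4' : ∀ x, m ≤ x → ∃ i < q, u' i x ≠ x ∨ w' i x ≠ x) :
    ∃ U W : ℕ → ℝ ≃o ℝ, IsSharpTuple q U W ∧
      (∀ i < q, ∀ x ≤ m, U i x = u i x ∧ W i x = w i x) ∧
      ∀ i < q, ∀ x, m ≤ x → U i x = u' i x ∧ W i x = w' i x := by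
  have hglue : ∀ i, ∃ e : (ℝ ≃o ℝ) × (ℝ ≃o ℝ), i < q →
      (∀ x ≤ m, e.1 x = u i x ∧ e.2 x = w i x) ∧ ∀ x, m ≤ x → e.1 x = u' i x ∧ e.2 x = w' i x := by
    intro i
    by_cases hi : i < q
    · have h5 : u i m = u' i m ∧ w i m = w' i m := by
        rcases eq_or_ne i 0 with rfl | h0
        · rw [(h3 m (by linarith)).1, (h3 m (by linarith)).2, (h3' m (by linarith)).1,
            (h3' m (by linarith)).2]
          exact ⟨rfl, rfl⟩
        · rw [(h2 i hi h0).1, (h2 i hi h0).2, (h2' i hi h0).1, (h2' i hi h0).2]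
          exact ⟨rfl, rfl⟩
      obtain ⟨e, he, he'⟩ := exists_orderIso_glue (u i) (u' i) h5.1
      obtain ⟨d, hd, hd'⟩ := exists_orderIso_glue (w i) (w' i) h5.2
      exact ⟨(e, d), fun _ => ⟨fun x hx => ⟨he x hx, hd x hx⟩, fun x hx => ⟨he' x hx, hd' x hx⟩⟩⟩
    · exact ⟨1, fun h => absurd h hi⟩
  choose e he using hglue
  refine ⟨fun i => (e i).1, fun i => (e i).2, ⟨?_, fun x => ?_⟩, fun i hi => (he i hi).1,
    fun i hi => (he i hi).2⟩
  · ext x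
    rw [RelIso.one_apply]
    rcases le_total x m with hx | hx
    · refine Eq.trans ?_ (h1 x hx)
      refine (surfaceWord_congr_on (s := Iic m) (fun i hi y hy => ?_) x hx).1
      obtain ⟨h6, h7⟩ := he i hi
      rcases eq_or_ne i 0 with rfl | h0
      · exact commutator_congr_Iic (m' := m - 1) (by rw [(h3 _ le_rfl).1]; ring) (h3 _ le_rfl).2
          (h3 m (by linarith)).2 (fun z hz => (h6 z (by linarith)).1)
          (fun z hz => (h6 z (by linarith)).2) (fun z hz => (h6 z hz).2) y hy
      · exact commutator_congr_Iic (h2 i hi h0).1 (h2 i hi h0).2 (h2 i hi h0).2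
          (fun z hz => (h6 z hz).1) (fun z hz => (h6 z hz).2) (fun z hz => (h6 z hz).2) y hy
    · refine Eq.trans ?_ (h1' x hx)
      refine (surfaceWord_congr_on (s := Ici m) (fun i hi y hy => ?_) x hx).1
      obtain ⟨h6, h7⟩ := he i hi
      rcases eq_or_ne i 0 with rfl | h0
      -- The commutator at points above `m` evaluates letters down to `m - 1`, where the left tuple
      -- was used; there it coincides with the right one.
      · have h8 : ∀ z, m - 1 ≤ z → (e 0).1 z = u' 0 z ∧ (e 0).2 z = w' 0 z := by
          intro z hz
          rcases le_total z m with h | h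
          · rw [(h6 z h).1, (h6 z h).2, (h3 z hz).1, (h3 z hz).2, (h3' z (by linarith)).1,
              (h3' z (by linarith)).2]
            exact ⟨rfl, rfl⟩
          · exact h7 z h
        exact commutator_congr_Ici (m' := m - 1) (by rw [(h3' _ (by linarith)).1]; ring)
          (h3' _ (by linarith)).2 (h3' m (by linarith)).2 (fun z hz => (h8 z hz).1)
          (fun z hz => (h8 z hz).2) (fun z hz => (h7 z hz).2) y hy
      · exact commutator_congr_Ici (h2' i hi h0).1 (h2' i hi h0).2 (h2' i hi h0).2
          (fun z hz => (h7 z hz).1) (fun z hz => (h7 z hz).2) (fun z hz => (h7 z hz).2) y hy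
  · rcases le_total x m with hx | hx
    · obtain ⟨i, hi, h5⟩ := h4 x hx
      exact ⟨i, hi, by rwa [((he i hi).1 x hx).1, ((he i hi).1 x hx).2]⟩
    · obtain ⟨i, hi, h5⟩ := h4' x hx
      exact ⟨i, hi, by rwa [((he i hi).2 x hx).1, ((he i hi).2 x hx).2]⟩

/-- Two tuples can be joined: there is one which agrees with the first on `(-∞, N]`, and whose
conjugate by a translation agrees with the second on `[-N, ∞)`. -/
theorem IsSharpTuple.exists_join {q : ℕ} (hq : 2 ≤ q) {u₁ w₁ u₂ w₂ : ℕ → ℝ ≃o ℝ}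
    (h₁ : IsSharpTuple q u₁ w₁) (h₂ : IsSharpTuple q u₂ w₂) (N : ℝ) :
    ∃ (U W : ℕ → ℝ ≃o ℝ) (T : ℝ), IsSharpTuple q U W ∧
      (∀ i < q, ∀ x ≤ N, U i x = u₁ i x ∧ W i x = w₁ i x) ∧
      ∀ i < q, ∀ x, -N ≤ x → U i (x + T) = u₂ i x + T ∧ W i (x + T) = w₂ i x + T := by
  obtain ⟨p, rfl⟩ : ∃ p, q = p + 1 := ⟨q - 1, by omega⟩
  have hp : 0 < p := by omega
  obtain ⟨m₁, hm₁, u, w, a1, a2, a3, a4, a5⟩ := h₁.exists_left hp one_ne_zero le_rfl N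
  obtain ⟨m₂, hm₂, u', w', b1, b2, b3, b4, b5⟩ := h₂.exists_right hp (ε := 1) one_ne_zero
    (by norm_num) (-N)
  -- The translation carrying the cut point of the second tuple to that of the first.
  obtain ⟨T, hT⟩ : ∃ T, T = m₁ - m₂ := ⟨_, rfl⟩
  obtain ⟨c, hc⟩ : ∃ c : (ℝ ≃o ℝ) →* (ℝ ≃o ℝ), ∀ e x, c e x = e (x - T) + T :=
    ⟨(MulAut.conj (OrderIso.addRight T)).toMonoidHom, fun e x => by
      change e ((OrderIso.addRight T).symm x) + T = _
      congr 2⟩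
  obtain ⟨U, W, c1, c2, c3⟩ := exists_isSharpTuple_glue (q := p + 1) (m := m₁) (u := u) (w := w)
    (u' := fun i => c (u' i)) (w' := fun i => c (w' i)) a2
    (fun x hx => by rw [← map_surfaceWord, hc, b2 _ (by linarith)]; ring) a3
    (fun i hi h0 => by
      have h : m₁ - T = m₂ := by linarith
      rw [hc, hc, h, (b3 i hi h0).1, (b3 i hi h0).2, hT]
      constructor <;> ring) a4
    (fun x hx => by
      rw [hc, hc, (b4 (x - T) (by linarith)).1, (b4 (x - T) (by linarith)).2]
      constructor <;> ring) a5
    (fun x hx => by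
      obtain ⟨i, hi, h⟩ := b5 (x - T) (by linarith)
      refine ⟨i, hi, h.imp (fun h7 h8 => h7 ?_) fun h7 h8 => h7 ?_⟩ <;>
      · rw [hc] at h8
        linarith)
  refine ⟨U, W, T, c1, fun i hi x hx => ?_, fun i hi x hx => ?_⟩
  · rw [(c2 i hi x (by linarith)).1, (c2 i hi x (by linarith)).2]
    exact a1 i hi x hx
  · rw [(c3 i hi (x + T) (by linarith)).1, (c3 i hi (x + T) (by linarith)).2, hc, hc,
      add_sub_cancel_right, (b1 i hi x hx).1, (b1 i hi x hx).2]
    exact ⟨rfl, rfl⟩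

end SurfaceTuples

end

/-! ### Representations, translations and connectedness. -/

noncomputable section

open Set Topology

section Representations

/-- Orientation preserving homeomorphisms of the line as order automorphisms. -/
def homeoPlusEquiv : HomeoPlus ≃* (ℝ ≃o ℝ) where
  toFun f := ⟨f.1.toEquiv, StrictMono.le_iff_le f.2⟩
  invFun e := ⟨e.toHomeomorph, e.strictMono⟩
  left_inv _ := rfl
  right_inv _ := rfl
  map_mul' _ _ := rfl

theorem homeoPlusEquiv_apply (f : HomeoPlus) (x : ℝ) : homeoPlusEquiv f x = (f : ℝ ≃ₜ ℝ) x := rfl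

theorem HomeoPlus.coe_mul_apply (f g : HomeoPlus) (x : ℝ) :
    ((f * g : HomeoPlus) : ℝ ≃ₜ ℝ) x = (f : ℝ ≃ₜ ℝ) ((g : ℝ ≃ₜ ℝ) x) := rfl

theorem HomeoPlus.coe_inv_apply_eq_iff (f : HomeoPlus) (x y : ℝ) :
    ((f⁻¹ : HomeoPlus) : ℝ ≃ₜ ℝ) x = y ↔ x = (f : ℝ ≃ₜ ℝ) y :=
  (f : ℝ ≃ₜ ℝ).toEquiv.symm_apply_eq

variable {G : Type*} [Group G]

/-- The conjugate of a representation by the translation by `t`. -/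
def translateRep (ρ : RepHomeoPlus G) (t : ℝ) : RepHomeoPlus G :=
  (MulAut.conj (homeoPlusEquiv.symm (OrderIso.addRight t))).toMonoidHom.comp ρ

theorem translateRep_apply (ρ : RepHomeoPlus G) (t : ℝ) (g : G) (x : ℝ) :
    (translateRep ρ t g : ℝ ≃ₜ ℝ) x = (ρ g : ℝ ≃ₜ ℝ) (x - t) + t := by
  change (ρ g : ℝ ≃ₜ ℝ) ((OrderIso.addRight t).symm x) + t = _
  congr 2

theorem translateRep_zero (ρ : RepHomeoPlus G) : translateRep ρ 0 = ρ := by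
  ext g x
  rw [translateRep_apply, sub_zero, add_zero]

theorem translateRep_mem_repSharp {ρ : RepHomeoPlus G} (h : ρ ∈ RepSharp G) (t : ℝ) :
    translateRep ρ t ∈ RepSharp G := by
  refine eq_empty_of_forall_notMem fun x hx => ?_
  have h1 : x - t ∈ globalFix ρ := fun g => by
    have := hx g
    rw [translateRep_apply] at this
    linarith
  rw [show globalFix ρ = ∅ from h] at h1
  exact h1

theorem continuous_translateRep (ρ : RepHomeoPlus G) : Continuous (translateRep ρ) := by
  refine continuous_induced_rng.2 (continuous_pi fun g => continuous_induced_rng.2 ?_)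
  refine ContinuousMap.continuous_of_continuous_uncurry _ ?_
  have h : Continuous fun p : ℝ × ℝ => (ρ g : ℝ ≃ₜ ℝ) (p.2 - p.1) + p.1 :=
    ((ρ g : ℝ ≃ₜ ℝ).continuous.comp (continuous_snd.sub continuous_fst)).add continuous_fst
  exact h.congr fun p => (translateRep_apply ρ p.1 g p.2).symm

/-- Eventual equality on every compact set passes to products and inverses, since images of compact
sets under the limit are compact; so generators suffice. -/
theorem tendsto_rep_of_eventually_eqOn {ι : Type*} {l : Filter ι} {S : Set G}
    (hS : Subgroup.closure S = ⊤) {r : ι → RepHomeoPlus G} {ρ : RepHomeoPlus G}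
    (h : ∀ g ∈ S, ∀ K : Set ℝ, IsCompact K →
      ∀ᶠ n in l, EqOn (r n g : ℝ ≃ₜ ℝ) (ρ g : ℝ ≃ₜ ℝ) K) :
    Filter.Tendsto r l (𝓝 ρ) := by
  have key : ∀ g : G, ∀ K : Set ℝ, IsCompact K →
      ∀ᶠ n in l, EqOn (r n g : ℝ ≃ₜ ℝ) (ρ g : ℝ ≃ₜ ℝ) K := by
    intro g
    have hg : g ∈ Subgroup.closure S := hS ▸ Subgroup.mem_top g
    induction hg using Subgroup.closure_induction with
    | mem g hg => exact h g hg
    | one =>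
      refine fun K _ => Filter.Eventually.of_forall fun n x _ => ?_
      rw [map_one, map_one]
    | mul a b _ _ iha ihb =>
      intro K hK
      filter_upwards [ihb K hK, iha _ (hK.image (ρ b : ℝ ≃ₜ ℝ).continuous)] with n h1 h2 x hx
      rw [map_mul, map_mul, HomeoPlus.coe_mul_apply, HomeoPlus.coe_mul_apply, h1 hx]
      exact h2 (mem_image_of_mem _ hx)
    | inv a _ iha =>
      intro K hK
      filter_upwards [iha _ (hK.image (ρ a⁻¹ : ℝ ≃ₜ ℝ).continuous)] with n h1 x hx
      rw [map_inv, HomeoPlus.coe_inv_apply_eq_iff, h1 (mem_image_of_mem _ hx),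
        ← HomeoPlus.coe_inv_apply_eq_iff, map_inv]
  refine (IsInducing.mk rfl : IsInducing fun (ρ : RepHomeoPlus G) (g : G) => ρ g).tendsto_nhds_iff.2
    (tendsto_pi_nhds.2 fun g => ?_)
  refine (IsInducing.mk rfl : IsInducing
    fun f : HomeoPlus => ((f : ℝ ≃ₜ ℝ) : C(ℝ, ℝ))).tendsto_nhds_iff.2 ?_
  refine ContinuousMap.tendsto_nhds_compactOpen.2 fun K hK U _ hKU => ?_
  filter_upwards [key g K hK] with n hn x hx
  exact (hn hx).symm ▸ hKU hx

theorem mem_repSharp_iff {q : ℕ} {u w : ℕ → G}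
    (hgen : Subgroup.closure {g | ∃ i < q, g = u i ∨ g = w i} = ⊤) (hword : surfaceWord u w q = 1)
    (ρ : RepHomeoPlus G) : ρ ∈ RepSharp G ↔
      IsSharpTuple q (fun i => homeoPlusEquiv (ρ (u i))) fun i => homeoPlusEquiv (ρ (w i)) := by
  constructor
  · refine fun h => ⟨?_, fun x => ?_⟩
    · have := map_surfaceWord (homeoPlusEquiv.toMonoidHom.comp ρ) u w q
      rw [hword, map_one] at this
      exact this.symm
    · by_contra! hcon
      have hx : x ∈ globalFix ρ := by
        intro g
        have hg : g ∈ Subgroup.closure {g | ∃ i < q, g = u i ∨ g = w i} :=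
          hgen ▸ Subgroup.mem_top g
        induction hg using Subgroup.closure_induction with
        | mem g hg =>
          obtain ⟨i, hi, rfl | rfl⟩ := hg
          exacts [(hcon i hi).1, (hcon i hi).2]
        | one => rw [map_one]; rfl
        | mul a b _ _ iha ihb => rw [map_mul, HomeoPlus.coe_mul_apply, ihb, iha]
        | inv a _ iha => rw [map_inv, HomeoPlus.coe_inv_apply_eq_iff, iha]
      rw [show globalFix ρ = ∅ from h] at hx
      exact hx
  · refine fun h => eq_empty_of_forall_notMem fun x hx => ?_
    obtain ⟨i, _, h1 | h1⟩ := h.2 x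
    exacts [h1 (hx _), h1 (hx _)]

/-- Any two points are limits of pairs of points on common translation orbits, and such orbits are
connected subsets of `RepSharp`. -/
theorem IsSurfaceGroupFor.isConnected_repSharp {q : ℕ} (hq : 2 ≤ q)
    (hG : IsSurfaceGroupFor HomeoPlus q G) : IsConnected (RepSharp G) := by
  obtain ⟨u, w, hgen, hword, huniv⟩ := hG
  have hrep : ∀ U W, IsSharpTuple q U W → ∃ ρ ∈ RepSharp G,
      ∀ i < q, homeoPlusEquiv (ρ (u i)) = U i ∧ homeoPlusEquiv (ρ (w i)) = W i := by
    intro U W h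
    obtain ⟨ρ, hρ⟩ := huniv (fun i => homeoPlusEquiv.symm (U i))
      (fun i => homeoPlusEquiv.symm (W i)) (by
        have := map_surfaceWord homeoPlusEquiv.symm.toMonoidHom U W q
        rw [h.1, map_one] at this
        exact this.symm)
    have hρ' : ∀ i < q, homeoPlusEquiv (ρ (u i)) = U i ∧ homeoPlusEquiv (ρ (w i)) = W i :=
      fun i hi => by simp [hρ i hi]
    refine ⟨ρ, (mem_repSharp_iff hgen hword ρ).2 ⟨?_, fun x => ?_⟩, hρ'⟩
    · rw [surfaceWord_congr (fun i hi => (hρ' i hi).1) fun i hi => (hρ' i hi).2, h.1]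
    · obtain ⟨i, hi, h1⟩ := h.2 x
      exact ⟨i, hi, by simpa only [(hρ' i hi).1, (hρ' i hi).2] using h1⟩
  refine ⟨?_, fun O₁ O₂ hO₁ hO₂ hsub ⟨ρ₁, hρ₁, hρ₁'⟩ ⟨ρ₂, hρ₂, hρ₂'⟩ => ?_⟩
  -- Nonemptiness: all generators act as the unit translation, so every commutator is trivial.
  · have h : IsSharpTuple q (fun _ => OrderIso.addRight 1) fun _ => OrderIso.addRight 1 :=
      ⟨by
        ext x
        exact surfaceWord_apply_eq_self fun i _ => by simp, fun x => ⟨0, by omega, by simp⟩⟩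
    obtain ⟨ρ, hρ, -⟩ := hrep _ _ h
    exact ⟨ρ, hρ⟩
  · have hjoin := fun N : ℕ => ((mem_repSharp_iff hgen hword ρ₁).1 hρ₁).exists_join hq
      ((mem_repSharp_iff hgen hword ρ₂).1 hρ₂) N
    choose U W T hsharp hleft hright using hjoin
    choose r hr hrU using fun N => hrep (U N) (W N) (hsharp N)
    have hbound : ∀ K : Set ℝ, IsCompact K → ∀ᶠ N : ℕ in Filter.atTop, ∀ x ∈ K, |x| ≤ N := by
      intro K hK
      obtain ⟨C, hC⟩ := hK.isBounded.exists_norm_le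
      filter_upwards [Filter.eventually_ge_atTop ⌈C⌉₊] with N hN x hx
      exact (hC x hx).trans ((Nat.le_ceil C).trans (Nat.cast_le.2 hN))
    have hlim₁ : Filter.Tendsto r Filter.atTop (𝓝 ρ₁) := by
      refine tendsto_rep_of_eventually_eqOn hgen fun g ⟨i, hi, hg⟩ K hK => ?_
      filter_upwards [hbound K hK] with N hN x hx
      have h1 := hleft N i hi x (abs_le.1 (hN x hx)).2
      rw [← (hrU N i hi).1, ← (hrU N i hi).2] at h1
      rcases hg with rfl | rfl
      exacts [h1.1, h1.2]
    have hlim₂ : Filter.Tendsto (fun N => translateRep (r N) (-T N)) Filter.atTop (𝓝 ρ₂) := by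
      refine tendsto_rep_of_eventually_eqOn hgen fun g ⟨i, hi, hg⟩ K hK => ?_
      filter_upwards [hbound K hK] with N hN x hx
      have h1 := hright N i hi x (abs_le.1 (hN x hx)).1
      rw [← (hrU N i hi).1, ← (hrU N i hi).2] at h1
      rw [translateRep_apply, sub_neg_eq_add, ← homeoPlusEquiv_apply, ← homeoPlusEquiv_apply]
      rcases hg with rfl | rfl
      · rw [h1.1, add_neg_cancel_right]
      · rw [h1.2, add_neg_cancel_right]
    -- For one large `N`, the orbit of `r N` meets `O₁` at parameter `0` and `O₂` at parameter `-T
    -- N`.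
    obtain ⟨N, h1, h2⟩ := ((hlim₁.eventually (hO₁.mem_nhds hρ₁')).and
      (hlim₂.eventually (hO₂.mem_nhds hρ₂'))).exists
    have hrange : range (translateRep (r N)) ⊆ RepSharp G :=
      range_subset_iff.2 (translateRep_mem_repSharp (hr N))
    obtain ⟨ρ, hρ, hρ'⟩ := isPreconnected_range (continuous_translateRep (r N)) O₁ O₂ hO₁ hO₂
      (hrange.trans hsub) ⟨r N, ⟨0, translateRep_zero _⟩, h1⟩ ⟨_, mem_range_self _, h2⟩
    exact ⟨ρ, hrange hρ, hρ'⟩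

end Representations

end

theorem mainTheorem5 (q : ℕ) (hq : 2 ≤ q) (S : Type*) [TopologicalSpace S]
    (hS : IsClosedOrientableSurface q S) (x : S) :
    IsConnected (RepSharp (FundamentalGroup S x)) :=
  (hS.isSurfaceGroupFor (by omega) x HomeoPlus).isConnected_repSharp hq
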